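/- Let $\bm a_1=(1,0)$ and $\bm b_\pm=\tfrac12(3,\pm\sqrt3)$ in $\mathbb R^2$. The hexagonal lattice has the vertex set $\mathcal V_{\mathrm{hex}}=\{n\bm b_++m\bm b_-\,,\ \bm a_1+n\bm b_++m\bm b_- : n,m\in\mathbb Z\}$, and two vertices $u,v$ are adjacent ($u\sim v$) if $\|u-v\|_2=1$. Its Laplacian $\Delta_{\mathrm{hex}}$ is the bounded self-adjoint operator on $\ell^2(\mathcal V_{\mathrm{hex}})$ given by $[\Delta_{\mathrm{hex}}\psi]_u=\sum_{v\sim u}\psi_v$. Let $Q:\mathcal V_{\mathrm{hex}}\to\mathbb R$ be the $(2,2)$-periodic potential (i.e. $Q(u+2\bm b_\pm)=Q(u)$) whose values $(q_1,\dots,q_8)$ at the vertices $$0,\quad \bm a_1,\quad \bm b_+,\quad \bm a_1+\bm b_+,\quad \bm b_-,\quad \bm a_1+\bm b_-,\quad \bm b_++\bm b_-,\quad \bm a_1+\bm b_++\bm b_-$$ are, in this order, $(1,-1,1,2,-2,-1,1,-1)$, and let $H_\lambda=\Delta_{\mathrm{hex}}+\lambda Q$, where $Q$ acts by multiplication. A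 gap of $\sigma(H_\lambda)$ is a bounded connected component of $\mathbb R\setminus\sigma(H_\lambda)$. There is $\lambda_0>0$ such that, for all real $\lambda$ with $0<|\lambda|<\lambda_0$, the spectrum $\sigma(H_\lambda)$ has exactly four connected components, and there are gaps $\mathfrak g_{1,\lambda}$, $\mathfrak g_{-1,\lambda}$, $\mathfrak g_{0,\lambda}$ of $\sigma(H_\lambda)$ (those that open at $1,-1,0$) with $$\Big(\pm1-\frac{\lambda^2}{20},\ \pm1+\frac{\lambda^2}{20}\Big)\subsetneq\mathfrak g_{\pm1,\lambda}\subseteq\Big(\pm1-\frac{\lambda^2}{2},\ \pm1+\frac{\lambda^2}{2}\Big)$$ and $$\Big(-\frac{|\lambda|}{5},\ \frac{|\lambda|}{5}\Big)\subsetneq\mathfrak g_{0,\lambda}\subsetneq\Big(-\frac{|\lambda|}{4},\ \frac{|\lambda|}{4}\Big).$$ -/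

import Mathlib

open scoped ENNReal

/-! ## Adjacency operators and Schrödinger operators on graphs of bounded degree -/

/-- The complex Hilbert space `ℓ²(V)`. -/
abbrev HilbertL2 (V : Type*) : Type _ := lp (fun _ : V => ℂ) 2

theorem sum_sq_neighborSum_le {V : Type*} (G : SimpleGraph V) [G.LocallyFinite] (d : ℕ)
    (hd : ∀ v, G.degree v ≤ d) (ψ : HilbertL2 V) (s : Finset V) :
    ∑ u ∈ s, ‖∑ v ∈ G.neighborFinset u, ψ v‖ ^ (2 : ℝ≥0∞).toReal ≤
      ((d : ℝ) * ‖ψ‖) ^ (2 : ℝ≥0∞).toReal := by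
  classical
  have h2 : ∀ x : ℝ, x ^ (2 : ℝ≥0∞).toReal = x ^ 2 := fun x => by simp
  have hψ : ∀ t : Finset V, ∑ v ∈ t, ‖ψ v‖ ^ 2 ≤ ‖ψ‖ ^ 2 := fun t => by
    simpa [h2] using lp.sum_rpow_le_norm_rpow (p := 2) (by simp) ψ t
  simp only [h2]
  have h1 : ∀ u, ‖∑ v ∈ G.neighborFinset u, ψ v‖ ^ 2 ≤
      (d : ℝ) * ∑ v ∈ G.neighborFinset u, ‖ψ v‖ ^ 2 := fun u => by
    calc ‖∑ v ∈ G.neighborFinset u, ψ v‖ ^ 2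
        ≤ (∑ v ∈ G.neighborFinset u, ‖ψ v‖) ^ 2 := by gcongr; exact norm_sum_le _ _
      _ ≤ ((G.neighborFinset u).card : ℝ) * ∑ v ∈ G.neighborFinset u, ‖ψ v‖ ^ 2 :=
          sq_sum_le_card_mul_sum_sq
      _ ≤ (d : ℝ) * ∑ v ∈ G.neighborFinset u, ‖ψ v‖ ^ 2 := by
          gcongr
          exact hd u
  have hswap : ∑ u ∈ s, ∑ v ∈ G.neighborFinset u, ‖ψ v‖ ^ 2 =
      ∑ v ∈ (s.biUnion fun u => G.neighborFinset u), ∑ u ∈ s with G.Adj v u, ‖ψ v‖ ^ 2 := by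
    refine Finset.sum_comm' fun u v => ?_
    simp only [SimpleGraph.mem_neighborFinset, Finset.mem_filter, Finset.mem_biUnion]
    exact ⟨fun h => ⟨⟨h.1, h.2.symm⟩, u, h⟩, fun h => ⟨h.1.1, h.1.2.symm⟩⟩
  calc ∑ u ∈ s, ‖∑ v ∈ G.neighborFinset u, ψ v‖ ^ 2
      ≤ ∑ u ∈ s, (d : ℝ) * ∑ v ∈ G.neighborFinset u, ‖ψ v‖ ^ 2 :=
        Finset.sum_le_sum fun u _ => h1 u
    _ = d * ∑ v ∈ (s.biUnion fun u => G.neighborFinset u), ∑ u ∈ s with G.Adj v u, ‖ψ v‖ ^ 2 := by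
        rw [← Finset.mul_sum, hswap]
    _ ≤ d * ∑ v ∈ (s.biUnion fun u => G.neighborFinset u), (d : ℝ) * ‖ψ v‖ ^ 2 := by
        gcongr with v _
        rw [Finset.sum_const, nsmul_eq_mul]
        gcongr
        refine le_trans (Finset.card_le_card fun u hu => ?_) (hd v)
        simpa using (Finset.mem_filter.mp hu).2
    _ = (d : ℝ) ^ 2 * ∑ v ∈ (s.biUnion fun u => G.neighborFinset u), ‖ψ v‖ ^ 2 := by
        rw [← Finset.mul_sum]; ring
    _ ≤ (d : ℝ) ^ 2 * ‖ψ‖ ^ 2 := by gcongr; exact hψ _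
    _ = ((d : ℝ) * ‖ψ‖) ^ 2 := by ring

/-- The graph Laplacian (adjacency operator) `[Δψ]_u = ∑_{v ∼ u} ψ_v` as a bounded operator on
`ℓ²(V)`. The degree bound `d` is needed only to make the operator bounded. -/
noncomputable def graphLaplacian {V : Type*} (G : SimpleGraph V) [G.LocallyFinite] (d : ℕ)
    (hd : ∀ v, G.degree v ≤ d) : HilbertL2 V →L[ℂ] HilbertL2 V :=
  LinearMap.mkContinuous
    { toFun := fun ψ => ⟨fun u => ∑ v ∈ G.neighborFinset u, ψ v,
        memℓp_gen' (sum_sq_neighborSum_le G d hd ψ)⟩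
      map_add' := fun ψ φ => by
        ext u
        exact Finset.sum_add_distrib
      map_smul' := fun c ψ => by
        ext u
        simp [Finset.mul_sum] }
    d
    fun ψ => lp.norm_le_of_forall_sum_le (by simp) (by positivity)
      (sum_sq_neighborSum_le G d hd ψ)

theorem graphLaplacian_apply {V : Type*} (G : SimpleGraph V) [G.LocallyFinite] (d : ℕ)
    (hd : ∀ v, G.degree v ≤ d) (ψ : HilbertL2 V) (u : V) :
    graphLaplacian G d hd ψ u = ∑ v ∈ G.neighborFinset u, ψ v := rfl

/-- Multiplication `[Qψ]_u = Q(u) ψ_u` by a bounded real potential, as a bounded operator on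
`ℓ²(V)`. The bound `C` is needed only to make the operator bounded. -/
noncomputable def potentialOp {V : Type*} (Q : V → ℝ) (C : ℝ) (hC : 0 ≤ C)
    (hQ : ∀ v, |Q v| ≤ C) : HilbertL2 V →L[ℂ] HilbertL2 V :=
  lp.mapCLM 2 (fun v => (Q v : ℂ) • ContinuousLinearMap.id ℂ ℂ) hC
    (fun v => by simpa [norm_smul] using hQ v)

theorem potentialOp_apply {V : Type*} (Q : V → ℝ) (C : ℝ) (hC : 0 ≤ C)
    (hQ : ∀ v, |Q v| ≤ C) (ψ : HilbertL2 V) (u : V) :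
    potentialOp Q C hC hQ ψ u = (Q u : ℂ) * ψ u := rfl

/-! ## The hexagonal lattice -/

/-- Labels of the vertices of the hexagonal lattice: `((n, m), false)` is the vertex
`n b₊ + m b₋`, and `((n, m), true)` is the vertex `a₁ + n b₊ + m b₋`. -/
abbrev HexVertex : Type := (ℤ × ℤ) × Bool

/-- `a₁ = (1, 0)`. -/
noncomputable def hexA : EuclideanSpace ℝ (Fin 2) := !₂[1, 0]

/-- `b₊ = (3, √3) / 2`. -/
noncomputable def hexBPlus : EuclideanSpace ℝ (Fin 2) := !₂[3 / 2, √3 / 2]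

/-- `b₋ = (3, -√3) / 2`. -/
noncomputable def hexBMinus : EuclideanSpace ℝ (Fin 2) := !₂[3 / 2, -(√3 / 2)]

/-- The point of the Euclidean plane at which a vertex of the hexagonal lattice lies. -/
noncomputable def hexPos (v : HexVertex) : EuclideanSpace ℝ (Fin 2) :=
  (if v.2 then hexA else 0) + (v.1.1 : ℝ) • hexBPlus + (v.1.2 : ℝ) • hexBMinus

/-- The hexagonal lattice: two vertices are joined when their Euclidean distance is one. -/
noncomputable def hexGraph : SimpleGraph HexVertex where
  Adj u v := dist (hexPos u) (hexPos v) = 1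
  symm := ⟨fun u v h => by rw [dist_comm]; exact h⟩
  loopless := ⟨fun u h => by simp at h⟩

/-- Distinct labels give distinct points of the plane. -/
theorem hexPos_injective : Function.Injective hexPos := by
  rintro ⟨⟨n, m⟩, s⟩ ⟨⟨n', m'⟩, s'⟩ h
  have h0 := congrArg (fun x : EuclideanSpace ℝ (Fin 2) => x 0) h
  have h1 := congrArg (fun x : EuclideanSpace ℝ (Fin 2) => x 1) h
  have h3 : √3 ≠ 0 := by positivity
  have key : n - m = n' - m' := by
    have : ((n : ℝ) - m - (n' - m')) * √3 = 0 := by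
      cases s <;> cases s' <;> simp [hexPos, hexA, hexBPlus, hexBMinus] at h1 <;> linarith
    have := (mul_eq_zero.mp this).resolve_right h3
    exact_mod_cast sub_eq_zero.mp this
  have key2 : 3 * (n + m) + (if s then 2 else 0) = 3 * (n' + m') + (if s' then 2 else 0) := by
    have : 3 * ((n : ℝ) + m) + (if s then 2 else 0) = 3 * (n' + m') + (if s' then 2 else 0) := by
      cases s <;> cases s' <;> simp [hexPos, hexA, hexBPlus, hexBMinus] at h0 ⊢ <;> linarith
    exact_mod_cast this
  cases s <;> cases s' <;> simp at key2 ⊢ <;> omega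

/-- The three neighbours of a vertex of the hexagonal lattice. -/
def hexNeighbors : HexVertex → Finset HexVertex
  | ((n, m), false) => {((n, m), true), ((n, m - 1), true), ((n - 1, m), true)}
  | ((n, m), true) => {((n, m), false), ((n, m + 1), false), ((n + 1, m), false)}

theorem mem_hexNeighbors (u v : HexVertex) : v ∈ hexNeighbors u ↔ hexGraph.Adj u v := by
  obtain ⟨⟨n, m⟩, s⟩ := u
  obtain ⟨⟨n', m'⟩, s'⟩ := v
  have h3 : √(3 : ℝ) ^ 2 = 3 := Real.sq_sqrt (by norm_num)
  have hadj : hexGraph.Adj ((n, m), s) ((n', m'), s') ↔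
      (3 * ((n' + m') - (n + m)) + 2 * ((if s' then 1 else 0) - (if s then 1 else 0))) ^ 2 +
        3 * ((n' - m') - (n - m)) ^ 2 = (4 : ℤ) := by
    change dist _ _ = (1 : ℝ) ↔ _
    rw [EuclideanSpace.dist_eq, Real.sqrt_eq_one, Fin.sum_univ_two, Real.dist_eq, Real.dist_eq,
      sq_abs, sq_abs, ← Int.cast_inj (α := ℝ)]
    cases s <;> cases s' <;> simp [hexPos, hexA, hexBPlus, hexBMinus] <;>
      constructor <;> intro h <;>
      first
      | linear_combination 4 * h - (((n : ℝ) - m) - (n' - m')) ^ 2 * h3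
      | linear_combination h / 4 + (((n : ℝ) - m) - (n' - m')) ^ 2 / 4 * h3
  rw [hadj]
  have key : ∀ e : ℤ, (3 * ((n' + m') - (n + m)) + 2 * e) ^ 2 + 3 * ((n' - m') - (n - m)) ^ 2 = 4 →
      -1 ≤ (n' - m') - (n - m) ∧ (n' - m') - (n - m) ≤ 1 ∧
      -2 ≤ 3 * ((n' + m') - (n + m)) + 2 * e ∧ 3 * ((n' + m') - (n + m)) + 2 * e ≤ 2 :=
    fun e h => ⟨by nlinarith, by nlinarith, by nlinarith, by nlinarith⟩
  generalize hx : (n' - m') - (n - m) = x at key ⊢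
  generalize hy : (n' + m') - (n + m) = y at key ⊢
  cases s <;> cases s' <;>
    simp only [hexNeighbors, Finset.mem_insert, Finset.mem_singleton, Prod.mk.injEq,
      if_true, if_false, Bool.false_eq_true, Bool.true_eq_false, and_false, and_true, or_false,
      false_iff, sub_self, sub_zero, zero_sub, mul_zero, add_zero]
  · intro h
    obtain ⟨h1, h2, h4, h5⟩ := key 0 (by linarith)
    have hy0 : y = 0 := by omega
    rw [hy0] at h
    interval_cases x <;> norm_num at h
  · constructor
    · rintro (⟨rfl, rfl⟩ | ⟨rfl, rfl⟩ | ⟨rfl, rfl⟩) <;> ring_nf at hx hy <;> subst hx hy <;> norm_num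
    · intro h
      obtain ⟨h1, h2, h4, h5⟩ := key 1 h
      have : -1 ≤ y ∧ y ≤ 0 := by omega
      obtain ⟨h6, h7⟩ := this
      interval_cases x <;> interval_cases y <;> omega
  · constructor
    · rintro (⟨rfl, rfl⟩ | ⟨rfl, rfl⟩ | ⟨rfl, rfl⟩) <;> ring_nf at hx hy <;> subst hx hy <;> norm_num
    · intro h
      obtain ⟨h1, h2, h4, h5⟩ := key (-1) h
      have : 0 ≤ y ∧ y ≤ 1 := by omega
      obtain ⟨h6, h7⟩ := this
      interval_cases x <;> interval_cases y <;> omega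
  · intro h
    obtain ⟨h1, h2, h4, h5⟩ := key 0 (by linarith)
    have hy0 : y = 0 := by omega
    rw [hy0] at h
    interval_cases x <;> norm_num at h

noncomputable instance : hexGraph.LocallyFinite := fun u =>
  Fintype.subtype (hexNeighbors u) fun v => mem_hexNeighbors u v

theorem hexGraph_neighborFinset (u : HexVertex) :
    hexGraph.neighborFinset u = hexNeighbors u := by
  ext v
  rw [SimpleGraph.mem_neighborFinset, mem_hexNeighbors]

theorem hexGraph_degree_le (u : HexVertex) : hexGraph.degree u ≤ 3 := by
  rw [← SimpleGraph.card_neighborFinset_eq_degree, hexGraph_neighborFinset]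
  obtain ⟨⟨n, m⟩, s⟩ := u
  cases s <;> exact Finset.card_le_three

/-! ## A `(2,2)`-periodic potential and the Schrödinger operators it defines -/

/-- The numbering (from `0`) of the eight vertices of a `2 × 2` fundamental cell:
`0, b₊, b₋, b₊ + b₋` have the numbers `0, 2, 4, 6`, and their translates by `a₁` have the numbers
`1, 3, 5, 7`. It is extended to all vertices with periods `2 b₊` and `2 b₋`. -/
def hexCellIndex (v : HexVertex) : Fin 8 :=
  match decide (Even v.1.1), decide (Even v.1.2), v.2 with
  | true, true, false => 0
  | true, true, true => 1
  | false, true, false => 2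
  | false, true, true => 3
  | true, false, false => 4
  | true, false, true => 5
  | false, false, false => 6
  | false, false, true => 7

/-- The `(2,2)`-periodic potential with the values `1, -1, 1, 2, -2, -1, 1, -1` on the eight
vertices of the fundamental cell. -/
def hexPotential (v : HexVertex) : ℝ :=
  (![1, -1, 1, 2, -2, -1, 1, -1] : Fin 8 → ℝ) (hexCellIndex v)

theorem abs_hexPotential_le (v : HexVertex) : |hexPotential v| ≤ 2 := by
  unfold hexPotential
  generalize hexCellIndex v = i
  fin_cases i <;> norm_num

/-- `H_λ = Δ_hex + λ Q`. -/
noncomputable def hexSchrodinger (lam : ℝ) : HilbertL2 HexVertex →L[ℂ] HilbertL2 HexVertex :=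
  graphLaplacian hexGraph 3 hexGraph_degree_le +
    (lam : ℂ) • potentialOp hexPotential 2 zero_le_two abs_hexPotential_le

/-- The neighbour of a vertex along the edges of one of the three directions. -/
def hexStep (a b : ℤ) : HexVertex ≃ HexVertex where
  toFun v := ((if v.2 then (v.1.1 + a, v.1.2 + b) else (v.1.1 - a, v.1.2 - b)), !v.2)
  invFun v := ((if v.2 then (v.1.1 + a, v.1.2 + b) else (v.1.1 - a, v.1.2 - b)), !v.2)
  left_inv v := by
    obtain ⟨⟨n, m⟩, s⟩ := v
    cases s <;> simp
  right_inv v := by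
    obtain ⟨⟨n, m⟩, s⟩ := v
    cases s <;> simp

theorem hexStep_hexStep (a b : ℤ) (v : HexVertex) : hexStep a b (hexStep a b v) = v :=
  (hexStep a b).left_inv v

theorem hexLaplacian_apply (ψ : HilbertL2 HexVertex) (u : HexVertex) :
    graphLaplacian hexGraph 3 hexGraph_degree_le ψ u =
      ψ (hexStep 0 0 u) + ψ (hexStep 0 1 u) + ψ (hexStep 1 0 u) := by
  rw [graphLaplacian_apply, hexGraph_neighborFinset]
  obtain ⟨⟨n, m⟩, s⟩ := u
  cases s
  · simp only [hexNeighbors]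
    rw [Finset.sum_insert (by simp; omega), Finset.sum_insert (by simp),
      Finset.sum_singleton]
    simp [hexStep, add_assoc]
  · simp [hexNeighbors, hexStep, add_assoc]

theorem isSelfAdjoint_hexSchrodinger (lam : ℝ) : IsSelfAdjoint (hexSchrodinger lam) := by
  have hΔ : IsSelfAdjoint (graphLaplacian hexGraph 3 hexGraph_degree_le) := by
    rw [ContinuousLinearMap.isSelfAdjoint_iff_isSymmetric]
    intro ψ φ
    have hs : ∀ a b : ℤ, Summable (fun u => inner ℂ (ψ (hexStep a b u)) (φ u)) := fun a b => by
      have h1 : Memℓp (fun u => ψ (hexStep a b u)) 2 :=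
        memℓp_gen (((lp.memℓp ψ).summable (by simp)).comp_injective (hexStep a b).injective)
      exact lp.summable_inner (𝕜 := ℂ) (⟨_, h1⟩ : HilbertL2 HexVertex) φ
    have hs' : ∀ a b : ℤ, Summable (fun u => inner ℂ (ψ u) (φ (hexStep a b u))) := fun a b => by
      have h1 : Memℓp (fun u => φ (hexStep a b u)) 2 :=
        memℓp_gen (((lp.memℓp φ).summable (by simp)).comp_injective (hexStep a b).injective)
      exact lp.summable_inner (𝕜 := ℂ) ψ (⟨_, h1⟩ : HilbertL2 HexVertex)
    have he : ∀ a b : ℤ, ∑' u, inner ℂ (ψ (hexStep a b u)) (φ u) =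
        ∑' u, inner ℂ (ψ u) (φ (hexStep a b u)) := fun a b => by
      rw [← (hexStep a b).tsum_eq (fun u => inner ℂ (ψ (hexStep a b u)) (φ u))]
      simp only [hexStep_hexStep]
    rw [lp.inner_eq_tsum, lp.inner_eq_tsum]
    simp only [ContinuousLinearMap.coe_coe, hexLaplacian_apply, inner_add_left, inner_add_right]
    rw [((hs 0 0).add (hs 0 1)).tsum_add (hs 1 0), (hs 0 0).tsum_add (hs 0 1),
      ((hs' 0 0).add (hs' 0 1)).tsum_add (hs' 1 0), (hs' 0 0).tsum_add (hs' 0 1),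
      he, he, he]
  have hQ : IsSelfAdjoint (potentialOp hexPotential 2 zero_le_two abs_hexPotential_le) := by
    rw [ContinuousLinearMap.isSelfAdjoint_iff_isSymmetric]
    intro ψ φ
    rw [lp.inner_eq_tsum, lp.inner_eq_tsum]
    refine tsum_congr fun u => ?_
    simp only [ContinuousLinearMap.coe_coe, potentialOp_apply]
    simp only [RCLike.inner_apply, map_mul, Complex.conj_ofReal]
    ring
  refine hΔ.add (IsSelfAdjoint.smul ?_ hQ)
  simp [isSelfAdjoint_iff]

/-- The real points of the spectrum of `H_λ`. By `spectrum_hexSchrodinger` below these are all of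
its points. -/
def hexSpectrum (lam : ℝ) : Set ℝ := {E : ℝ | (E : ℂ) ∈ spectrum ℂ (hexSchrodinger lam)}

theorem spectrum_hexSchrodinger (lam : ℝ) :
    spectrum ℂ (hexSchrodinger lam) = Complex.ofReal '' hexSpectrum lam := by
  ext z
  constructor
  · intro hz
    have h := (isSelfAdjoint_hexSchrodinger lam).mem_spectrum_eq_re hz
    exact ⟨z.re, by simpa [hexSpectrum, ← h] using hz, h.symm⟩
  · rintro ⟨E, hE, rfl⟩
    exact hE

/-- The potential has the periods `2 b₊` and `2 b₋`. -/
theorem hexPotential_periodic (n m : ℤ) (s : Bool) :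
    hexPotential ((n + 2, m), s) = hexPotential ((n, m), s) ∧
      hexPotential ((n, m + 2), s) = hexPotential ((n, m), s) := by
  constructor <;> simp [hexPotential, hexCellIndex]

/-! ## Gaps -/

/-- `(a, b)` is a gap of the closed set `S ⊆ ℝ`: a bounded connected component of its
complement, written through its endpoints. -/
def IsGap (S : Set ℝ) (a b : ℝ) : Prop :=
  a < b ∧ a ∈ S ∧ b ∈ S ∧ Disjoint (Set.Ioo a b) S

/-! Floquet theory turns the spectrum into the zero set of one explicit polynomial. A number `E` is
in the spectrum exactly when, for some quasimomentum, the 8×8 Bloch matrix has eigenvalue `E`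
(`mem_hexSpectrum_iff`). One direction cuts a Bloch wave off by a slowly decaying exponential,
giving approximate eigenvectors. The other combines Parseval on the torus with a lower bound that is
uniform by compactness.

The determinant of the Bloch matrix minus `E` depends only on `x = E² - 1`, `l = λ²`, and two
functions of the quasimomentum, `m = ∑ (1 - cos)` and `k = ∏ (1 - cos)` (`det_blochMatrix`).
Evenness in `E` and `λ` reflects two symmetries. A sign on one sublattice turns `Δ` into `-Δ`, and a
point inversion exchanging the sublattices turns this particular `Q` into `-Q`.

Every band edge is then read off at a special quasimomentum, because the elementary inequalities
between `m` and `k` make those points extremal. At quasimomentum zero, `m = k = 0` and the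
determinant is `(x - l)²` times a quadratic with roots near `-l/8` and `8`. Strictly between `x₁ ≈
-l/8` and `l` it is negative, and the other quasimomenta only lower it: this is the gap at `E² = 1`.
At the Dirac points, `m = 9/2` and `k = 27/8`; the determinant is close to `4l - 64E²` for small
`E`, so it stays positive until `E² ≈ l/16`, and the other quasimomenta only raise it there: this is
the gap at `0`.

Conversely, each energy in the claimed bands has determinants of opposite (weak) signs at two
quasimomenta, so connectedness of the plane of quasimomenta yields a zero. In terms of `F = E²` the
spectrum is `[F₀, F₁] ∪ [1 + l, F₂]` (`exists_bandDet_eq_zero_iff`), hence four intervals in `E`. -/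

/-! ### Resolvent set and lower bounds -/

/-- A self-adjoint operator that is bounded below is invertible. -/
theorem IsSelfAdjoint.isUnit_of_bounded_below {H : Type*} [NormedAddCommGroup H]
    [InnerProductSpace ℂ H] [CompleteSpace H] {T : H →L[ℂ] H} (hT : IsSelfAdjoint T) {c : ℝ}
    (hc : 0 < c) (h : ∀ x, c * ‖x‖ ≤ ‖T x‖) : IsUnit T := by
  rw [ContinuousLinearMap.isUnit_iff_bijective,
    ContinuousLinearMap.bijective_iff_dense_range_and_antilipschitz]
  have hinj : ∀ x, T x = 0 → x = 0 := fun x hx => by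
    have := h x
    rw [hx, norm_zero] at this
    have : ‖x‖ ≤ 0 := by nlinarith [norm_nonneg x]
    simpa using this
  constructor
  · rw [Submodule.topologicalClosure_eq_top_iff, ContinuousLinearMap.orthogonal_range,
      ← ContinuousLinearMap.star_eq_adjoint, hT.star_eq]
    rw [Submodule.eq_bot_iff]
    exact fun x hx => hinj x hx
  · refine ⟨Real.toNNReal c⁻¹, T.antilipschitz_of_bound fun x => ?_⟩
    rw [Real.coe_toNNReal _ (by positivity), inv_mul_eq_div, le_div_iff₀ hc, mul_comm]
    exact h x

theorem notMem_hexSpectrum_of_bounded_below {lam E c : ℝ} (hc : 0 < c)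
    (h : ∀ ψ, c * ‖ψ‖ ≤ ‖hexSchrodinger lam ψ - (E : ℂ) • ψ‖) : E ∉ hexSpectrum lam := by
  intro hE
  refine hE ?_
  rw [spectrum.mem_resolventSet_iff, ← neg_sub, IsUnit.neg_iff]
  refine IsSelfAdjoint.isUnit_of_bounded_below (c := c) ?_ hc fun ψ => ?_
  · refine (isSelfAdjoint_hexSchrodinger lam).sub ?_
    rw [IsSelfAdjoint, ← algebraMap_star_comm]
    simp
  · exact h ψ

/-- The constant is essentially the inverse of the norm of the resolvent; the `+ 1` only avoids a
separate argument that this norm is nonzero. -/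
theorem exists_bounded_below_of_notMem_hexSpectrum {lam E : ℝ} (hE : E ∉ hexSpectrum lam) :
    ∃ c > 0, ∀ ψ, c * ‖ψ‖ ≤ ‖hexSchrodinger lam ψ - (E : ℂ) • ψ‖ := by
  have hu : IsUnit (hexSchrodinger lam - algebraMap ℂ _ (E : ℂ)) := by
    rw [← neg_sub, IsUnit.neg_iff]
    exact not_not.mp hE
  obtain ⟨u, hu⟩ := hu
  set S : HilbertL2 HexVertex →L[ℂ] HilbertL2 HexVertex := ↑u⁻¹ with hS
  refine ⟨(‖S‖ + 1)⁻¹, by positivity, fun ψ => ?_⟩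
  rw [inv_mul_le_iff₀ (by positivity)]
  have h1 : S (hexSchrodinger lam ψ - (E : ℂ) • ψ) = ψ := by
    have h2 : S * ↑u = 1 := u.inv_mul
    rw [hu] at h2
    exact congrArg (fun T => T ψ) h2
  calc ‖ψ‖ = ‖S (hexSchrodinger lam ψ - (E : ℂ) • ψ)‖ := by rw [h1]
    _ ≤ ‖S‖ * ‖hexSchrodinger lam ψ - (E : ℂ) • ψ‖ := S.le_opNorm _
    _ ≤ _ := by gcongr; linarith

/-! ## Floquet theory -/

/-- The classes of vertices modulo the translations by `2 b₊` and `2 b₋`. -/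
abbrev HexCell : Type := (ZMod 2 × ZMod 2) × Bool

/-- The class of a vertex. -/
def hexCellOf (v : HexVertex) : HexCell := ((v.1.1, v.1.2), v.2)

/-- The potential as a function of the class of a vertex. -/
def cellPotential (c : HexCell) : ℝ :=
  if c.2 then (if c.1 = (1, 0) then 2 else -1) else (if c.1 = (0, 1) then -2 else 1)

/-- The class of the neighbour along the edges of one direction. -/
def cellStep (a b : ℤ) (c : HexCell) : HexCell :=
  ((if c.2 then (c.1.1 + a, c.1.2 + b) else (c.1.1 - a, c.1.2 - b)), !c.2)

theorem hexCellOf_hexStep (a b : ℤ) (v : HexVertex) :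
    hexCellOf (hexStep a b v) = cellStep a b (hexCellOf v) := by
  obtain ⟨⟨n, m⟩, s⟩ := v
  cases s <;> simp [hexCellOf, hexStep, cellStep]

theorem cellStep_cellStep (a b : ℤ) (c : HexCell) : cellStep a b (cellStep a b c) = c := by
  obtain ⟨⟨n, m⟩, s⟩ := c
  cases s <;> simp [cellStep]

theorem hexPotential_eq_cellPotential (v : HexVertex) :
    hexPotential v = cellPotential (hexCellOf v) := by
  obtain ⟨⟨n, m⟩, s⟩ := v
  have key : ∀ k : ℤ, (Even k ∧ (k : ZMod 2) = 0) ∨ (¬ Even k ∧ (k : ZMod 2) = 1) := fun k => by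
    rcases Int.even_or_odd k with h | h
    · exact Or.inl ⟨h, (ZMod.intCast_zmod_eq_zero_iff_dvd k 2).2 h.two_dvd⟩
    · refine Or.inr ⟨Int.not_even_iff_odd.2 h, ?_⟩
      obtain ⟨j, rfl⟩ := h
      have h2 : (2 : ZMod 2) = 0 := by decide
      push_cast
      rw [h2, zero_mul, zero_add]
  rcases key n with ⟨hn, hn'⟩ | ⟨hn, hn'⟩ <;> rcases key m with ⟨hm, hm'⟩ | ⟨hm, hm'⟩ <;> cases s <;>
    simp [hexPotential, hexCellIndex, cellPotential, hexCellOf, hn, hm, hn', hm']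

/-- The phase picked up by a Bloch wave along an edge that leaves a vertex of the class `c`. -/
noncomputable def cellPhase (ζ ω : ℂ) (a b : ℤ) (c : HexCell) : ℂ :=
  if c.2 then ζ ^ a * ω ^ b else ζ ^ (-a) * ω ^ (-b)

/-- The Bloch Hamiltonian. -/
noncomputable def blochHamiltonian (lam : ℝ) (ζ ω : ℂ) (φ : HexCell → ℂ) (c : HexCell) : ℂ :=
  cellPhase ζ ω 0 0 c * φ (cellStep 0 0 c) + cellPhase ζ ω 0 1 c * φ (cellStep 0 1 c) +
    cellPhase ζ ω 1 0 c * φ (cellStep 1 0 c) + lam * (cellPotential c * φ c)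

/-- The plane wave `ζ ^ n ω ^ m` on the vertices. -/
noncomputable def planeWave (ζ ω : ℂ) (v : HexVertex) : ℂ := ζ ^ v.1.1 * ω ^ v.1.2

theorem planeWave_hexStep {ζ ω : ℂ} (hζ : ζ ≠ 0) (hω : ω ≠ 0) (a b : ℤ) (v : HexVertex) :
    planeWave ζ ω (hexStep a b v) = cellPhase ζ ω a b (hexCellOf v) * planeWave ζ ω v := by
  obtain ⟨⟨n, m⟩, s⟩ := v
  cases s <;>
    simp [planeWave, hexStep, cellPhase, hexCellOf, zpow_add₀ hζ, zpow_add₀ hω, zpow_sub₀ hζ,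
      zpow_sub₀ hω] <;> field_simp

theorem norm_planeWave {ζ ω : ℂ} (hζ : ‖ζ‖ = 1) (hω : ‖ω‖ = 1) (v : HexVertex) :
    ‖planeWave ζ ω v‖ = 1 := by
  simp [planeWave, hζ, hω]

theorem hexSchrodinger_apply (lam : ℝ) (ψ : HilbertL2 HexVertex) (u : HexVertex) :
    hexSchrodinger lam ψ u = ψ (hexStep 0 0 u) + ψ (hexStep 0 1 u) + ψ (hexStep 1 0 u) +
      lam * (hexPotential u * ψ u) := by
  rw [← hexLaplacian_apply, ← potentialOp_apply hexPotential 2 zero_le_two abs_hexPotential_le]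
  rfl

/-- A Bloch wave is a generalized eigenfunction. -/
theorem blochWave_eigen {lam E : ℝ} {ζ ω : ℂ} (hζ : ζ ≠ 0) (hω : ω ≠ 0) {φ : HexCell → ℂ}
    (hφ : blochHamiltonian lam ζ ω φ = fun c => E * φ c) (u : HexVertex) :
    let v := fun u => planeWave ζ ω u * φ (hexCellOf u)
    v (hexStep 0 0 u) + v (hexStep 0 1 u) + v (hexStep 1 0 u) + lam * (hexPotential u * v u) =
      E * v u := by
  intro v
  have h := congrFun hφ (hexCellOf u)
  simp only [blochHamiltonian] at h
  simp only [v, planeWave_hexStep hζ hω, hexCellOf_hexStep, hexPotential_eq_cellPotential]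
  linear_combination planeWave ζ ω u * h

/-! ### Bloch waves give points of the spectrum -/

/-- An exponentially decaying weight on the vertices. -/
noncomputable def hexWeight (r : ℝ) (u : HexVertex) : ℝ := r ^ u.1.1.natAbs * r ^ u.1.2.natAbs

theorem hexWeight_pos {r : ℝ} (hr : 0 < r) (u : HexVertex) : 0 < hexWeight r u := by
  unfold hexWeight; positivity

theorem hexWeight_le_one {r : ℝ} (hr : 0 < r) (hr1 : r ≤ 1) (u : HexVertex) :
    hexWeight r u ≤ 1 :=
  mul_le_one₀ (pow_le_one₀ hr.le hr1) (by positivity) (pow_le_one₀ hr.le hr1)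

theorem summable_hexWeight {r : ℝ} (hr : 0 < r) (hr1 : r < 1) : Summable (hexWeight r) := by
  have h1 : Summable (fun n : ℤ => r ^ n.natAbs) := by
    apply Summable.of_nat_of_neg <;> simpa using summable_geometric_of_lt_one hr.le hr1
  have h2 : Summable (fun p : ℤ × ℤ => r ^ p.1.natAbs * r ^ p.2.natAbs) :=
    h1.mul_of_nonneg h1 (fun _ => by positivity) (fun _ => by positivity)
  have h3 : Summable (fun s : Bool => (1 : ℝ)) := Summable.of_finite
  refine (h2.mul_of_nonneg h3 (fun _ => by simp only [Pi.zero_apply]; positivity)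
    (fun _ => by simp)).congr fun u => ?_
  simp [hexWeight]

theorem mul_hexWeight_hexStep_le {r : ℝ} (hr : 0 < r) (hr1 : r ≤ 1) {a b : ℤ}
    (hab : a.natAbs + b.natAbs ≤ 1) (u : HexVertex) :
    r * hexWeight r (hexStep a b u) ≤ hexWeight r u := by
  unfold hexWeight
  rw [← pow_add, ← pow_add, ← pow_succ']
  refine pow_le_pow_of_le_one hr.le hr1 ?_
  obtain ⟨⟨n, m⟩, s⟩ := u
  cases s <;> simp [hexStep] <;> omega

/-- A step changes at most one label, and by at most one, so the weight changes by a factor between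
`r` and `1/r`. The bound uses the weight at the neighbour because that is where the Bloch wave is
evaluated in the cutoff error. -/
theorem abs_hexWeight_sub_le {r : ℝ} (hr : 0 < r) (hr1 : r ≤ 1) {a b : ℤ}
    (hab : a.natAbs + b.natAbs ≤ 1) (u : HexVertex) :
    |hexWeight r (hexStep a b u) - hexWeight r u| ≤ (1 / r - 1) * hexWeight r (hexStep a b u) := by
  have h1 := mul_hexWeight_hexStep_le hr hr1 hab u
  have h2 := mul_hexWeight_hexStep_le hr hr1 hab (hexStep a b u)
  rw [hexStep_hexStep] at h2
  have h3 := hexWeight_pos hr (hexStep a b u)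
  set x := hexWeight r (hexStep a b u)
  set y := hexWeight r u
  have h4 : y ≤ 1 / r * x := by
    rw [one_div, ← div_eq_inv_mul, le_div_iff₀ hr]; linarith
  have h5 : (1 - r) * x ≤ (1 / r - 1) * x := by
    refine mul_le_mul_of_nonneg_right ?_ h3.le
    have h6 : 1 / r - 1 - (1 - r) = (1 - r) ^ 2 / r := by field_simp
    have h7 : 0 ≤ (1 - r) ^ 2 / r := by positivity
    linarith
  rw [abs_le]
  constructor <;> linarith

theorem norm_graphLaplacian_apply_le (ψ : HilbertL2 HexVertex) :
    ‖graphLaplacian hexGraph 3 hexGraph_degree_le ψ‖ ≤ 3 * ‖ψ‖ := by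
  refine (ContinuousLinearMap.le_opNorm _ _).trans ?_
  gcongr
  exact_mod_cast LinearMap.mkContinuous_norm_le _ (by positivity) _

/-- A value of the energy with a nonzero Bloch wave belongs to the spectrum. -/
theorem mem_hexSpectrum_of_blochHamiltonian {lam E : ℝ} {ζ ω : ℂ} (hζ : ‖ζ‖ = 1) (hω : ‖ω‖ = 1)
    {φ : HexCell → ℂ} (hφ0 : φ ≠ 0)
    (hφ : blochHamiltonian lam ζ ω φ = fun c => E * φ c) : E ∈ hexSpectrum lam := by
  by_contra hE
  obtain ⟨c, hc, hb⟩ := exists_bounded_below_of_notMem_hexSpectrum hE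
  have hζ0 : ζ ≠ 0 := by rintro rfl; simp at hζ
  have hω0 : ω ≠ 0 := by rintro rfl; simp at hω
  -- The cutoff error is at most `3 (1/r - 1)` times the norm, with `3` the degree; this `r` makes
  -- it `c/2`, half of the supposed lower bound.
  set r : ℝ := 3 / (3 + c / 2) with hr
  have hr0 : 0 < r := by positivity
  have hr1 : r < 1 := by rw [hr, div_lt_one (by positivity)]; linarith
  have hδ : 3 * (1 / r - 1) = c / 2 := by rw [hr]; field_simp; ring
  set δ := 1 / r - 1 with hδd
  have hδ0 : 0 ≤ δ := by linarith
  have key := blochWave_eigen hζ0 hω0 hφ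
  set v : HexVertex → ℂ := fun u => planeWave ζ ω u * φ (hexCellOf u) with hv
  have hvn : ∀ u, ‖v u‖ = ‖φ (hexCellOf u)‖ := fun u => by
    simp [hv, norm_planeWave hζ hω]
  clear_value v
  have hvb : ∀ u, ‖v u‖ ≤ ‖φ‖ := fun u => by rw [hvn]; exact norm_le_pi_norm φ _
  have hsum : Summable fun u => (‖φ‖ * hexWeight r u) ^ 2 := by
    refine Summable.of_nonneg_of_le (fun _ => by positivity) (fun u => ?_)
      ((summable_hexWeight hr0 hr1).mul_left (‖φ‖ ^ 2))
    rw [mul_pow]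
    gcongr
    nlinarith [hexWeight_pos hr0 u, hexWeight_le_one hr0 hr1.le u]
  have hbd : ∀ u, ‖(hexWeight r u : ℂ) * v u‖ ≤ ‖φ‖ * hexWeight r u := fun u => by
    rw [norm_mul, Complex.norm_real, Real.norm_of_nonneg (hexWeight_pos hr0 u).le, mul_comm]
    gcongr
    · exact (hexWeight_pos hr0 u).le
    · exact hvb u
  have hmem : Memℓp (fun u => (hexWeight r u : ℂ) * v u) 2 := by
    refine memℓp_gen (Summable.of_nonneg_of_le (fun _ => by positivity) (fun u => ?_) hsum)
    simp only [ENNReal.toReal_ofNat, Real.rpow_ofNat]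
    gcongr
    exact hbd u
  set ψ : HilbertL2 HexVertex := ⟨_, hmem⟩ with hψ
  have hψa : ∀ u, ψ u = (hexWeight r u : ℂ) * v u := fun u => rfl
  -- With `|ψ|` as a vector of `ℓ²`, the pointwise error is dominated by `δ Δ|ψ|`, so the norm bound
  -- for `Δ` finishes the estimate.
  have hmem' : Memℓp (fun u => (‖ψ u‖ : ℂ)) 2 := by
    refine memℓp_gen ?_
    simpa using (lp.memℓp ψ).summable (by simp)
  set ψ' : HilbertL2 HexVertex := ⟨_, hmem'⟩ with hψ'
  have hψ'a : ∀ u, ψ' u = (‖ψ u‖ : ℂ) := fun u => rfl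
  have hψn : ‖ψ'‖ ≤ ‖ψ‖ := lp.norm_mono (by simp) fun u => by simp [hψ'a]
  have hψ0 : ψ ≠ 0 := by
    obtain ⟨⟨⟨i, j⟩, s⟩, hx⟩ := Function.ne_iff.mp hφ0
    intro h0
    have h1 : ψ (((i.val : ℤ), (j.val : ℤ)), s) = 0 := by rw [h0]; rfl
    rw [hψa] at h1
    have h2 := (mul_eq_zero.mp h1).resolve_left
      (Complex.ofReal_ne_zero.mpr (hexWeight_pos hr0 _).ne')
    have h3 := hvn (((i.val : ℤ), (j.val : ℤ)), s)
    rw [h2, norm_zero] at h3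
    refine hx (norm_eq_zero.mp ?_)
    rw [h3]
    simp [hexCellOf]
  have hpt : ∀ u, ‖(hexSchrodinger lam ψ - (E : ℂ) • ψ) u‖ ≤
      ‖((δ : ℂ) • graphLaplacian hexGraph 3 hexGraph_degree_le ψ') u‖ := fun u => by
    have e1 : (hexSchrodinger lam ψ - (E : ℂ) • ψ) u =
        hexSchrodinger lam ψ u - E * ψ u := rfl
    have e2 : ((δ : ℂ) • graphLaplacian hexGraph 3 hexGraph_degree_le ψ') u =
        δ * graphLaplacian hexGraph 3 hexGraph_degree_le ψ' u := rfl
    rw [e1, e2, hexSchrodinger_apply, hexLaplacian_apply]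
    have hk := key u
    simp only at hk
    have e3 : ψ (hexStep 0 0 u) + ψ (hexStep 0 1 u) + ψ (hexStep 1 0 u) +
        lam * (hexPotential u * ψ u) - E * ψ u =
        ((hexWeight r (hexStep 0 0 u) - hexWeight r u : ℝ) : ℂ) * v (hexStep 0 0 u) +
        ((hexWeight r (hexStep 0 1 u) - hexWeight r u : ℝ) : ℂ) * v (hexStep 0 1 u) +
        ((hexWeight r (hexStep 1 0 u) - hexWeight r u : ℝ) : ℂ) * v (hexStep 1 0 u) := by
      simp only [hψa]
      push_cast
      linear_combination (hexWeight r u : ℂ) * hk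
    have e4 : ∀ a b : ℤ, a.natAbs + b.natAbs ≤ 1 →
        ‖((hexWeight r (hexStep a b u) - hexWeight r u : ℝ) : ℂ) * v (hexStep a b u)‖ ≤
          δ * ‖ψ (hexStep a b u)‖ := fun a b hab => by
      rw [hψa, norm_mul, norm_mul, Complex.norm_real, Complex.norm_real, Real.norm_eq_abs,
        Real.norm_of_nonneg (hexWeight_pos hr0 _).le, ← mul_assoc]
      gcongr
      exact abs_hexWeight_sub_le hr0 hr1.le hab u
    rw [e3]
    refine (norm_add₃_le).trans ?_
    have e5 : ‖(δ : ℂ) * (ψ' (hexStep 0 0 u) + ψ' (hexStep 0 1 u) + ψ' (hexStep 1 0 u))‖ =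
        δ * (‖ψ (hexStep 0 0 u)‖ + ‖ψ (hexStep 0 1 u)‖ + ‖ψ (hexStep 1 0 u)‖) := by
      simp only [hψ'a]
      rw [← Complex.ofReal_add, ← Complex.ofReal_add, ← Complex.ofReal_mul, Complex.norm_real,
        Real.norm_of_nonneg (by positivity)]
    rw [e5]
    linarith [e4 0 0 (by simp), e4 0 1 (by simp), e4 1 0 (by simp)]
  have hle : ‖hexSchrodinger lam ψ - (E : ℂ) • ψ‖ ≤ c / 2 * ‖ψ‖ :=
    calc ‖hexSchrodinger lam ψ - (E : ℂ) • ψ‖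
        ≤ ‖(δ : ℂ) • graphLaplacian hexGraph 3 hexGraph_degree_le ψ'‖ :=
          lp.norm_mono (by simp) hpt
      _ = δ * ‖graphLaplacian hexGraph 3 hexGraph_degree_le ψ'‖ := by
          rw [norm_smul, Complex.norm_real, Real.norm_of_nonneg hδ0]
      _ ≤ δ * (3 * ‖ψ'‖) := by gcongr; exact norm_graphLaplacian_apply_le ψ'
      _ ≤ δ * (3 * ‖ψ‖) := by gcongr
      _ = c / 2 * ‖ψ‖ := by rw [← hδ]; ring
  have := hb ψ
  have : 0 < ‖ψ‖ := norm_pos_iff.mpr hψ0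
  nlinarith

/-! ### The Floquet transform and Parseval's identity -/

/-- The normalized Haar measure of a torus. -/
noncomputable abbrev torusMeasure (d : Type*) [Fintype d] :
    MeasureTheory.Measure (UnitAddTorus d) :=
  MeasureTheory.Measure.pi fun _ => AddCircle.haarAddCircle

open UnitAddTorus in
/-- Parseval's identity for trigonometric polynomials on a torus. -/
theorem integral_norm_sq_sum_mFourier {d ι : Type*} [Fintype d] (s : Finset ι) (k : ι → d → ℤ)
    (hk : Set.InjOn k s) (a : ι → ℂ) :
    ∫ t, ‖∑ i ∈ s, a i * mFourier (k i) t‖ ^ 2 ∂torusMeasure d = ∑ i ∈ s, ‖a i‖ ^ 2 := by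
  classical
  have ho : Orthonormal ℂ fun n : d → ℤ =>
      ContinuousMap.toLp (E := ℂ) 2 (torusMeasure d) ℂ (mFourier n) := orthonormal_mFourier
  rw [orthonormal_iff_ite] at ho
  set f : C(UnitAddTorus d, ℂ) := ∑ i ∈ s, a i • mFourier (k i) with hf
  have hft : ∀ t, f t = ∑ i ∈ s, a i * mFourier (k i) t := fun t => by
    simp [hf]
  have h1 : ((∫ t, ‖∑ i ∈ s, a i * mFourier (k i) t‖ ^ 2 ∂torusMeasure d : ℝ) : ℂ) =
      inner ℂ (ContinuousMap.toLp (E := ℂ) 2 (torusMeasure d) ℂ f)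
        (ContinuousMap.toLp (E := ℂ) 2 (torusMeasure d) ℂ f) := by
    rw [MeasureTheory.ContinuousMap.inner_toLp, ← integral_complex_ofReal]
    congr 1
    ext t
    rw [hft, Complex.mul_conj, Complex.normSq_eq_norm_sq]
  have h2 : ContinuousMap.toLp (E := ℂ) 2 (torusMeasure d) ℂ f =
      ∑ i ∈ s, a i • ContinuousMap.toLp (E := ℂ) 2 (torusMeasure d) ℂ (mFourier (k i)) := by
    simp [hf]
  rw [h2, sum_inner] at h1
  rw [← Complex.ofReal_inj, h1]
  push_cast
  refine Finset.sum_congr rfl fun i hi => ?_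
  rw [inner_sum, Finset.sum_eq_single i]
  · rw [inner_smul_left, inner_smul_right, ho, if_pos rfl, mul_one, mul_comm, Complex.mul_conj,
      Complex.normSq_eq_norm_sq]
    push_cast
    rfl
  · intro j hj hji
    rw [inner_smul_left, inner_smul_right, ho, if_neg fun h => hji (hk hj hi h.symm)]
    simp
  · exact fun h => absurd hi h

/-- The Floquet transform of a function on the vertices at the Bloch phases `ζ` and `ω`. -/
noncomputable def floquetTransform (ζ ω : ℂ) (ψ : HexVertex → ℂ) (c : HexCell) : ℂ :=
  ∑' u, if hexCellOf u = c then (planeWave ζ ω u)⁻¹ * ψ u else 0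

theorem planeWave_ne_zero {ζ ω : ℂ} (hζ : ζ ≠ 0) (hω : ω ≠ 0) (u : HexVertex) :
    planeWave ζ ω u ≠ 0 := mul_ne_zero (zpow_ne_zero _ hζ) (zpow_ne_zero _ hω)

theorem cellPhase_ne_zero {ζ ω : ℂ} (hζ : ζ ≠ 0) (hω : ω ≠ 0) (a b : ℤ) (c : HexCell) :
    cellPhase ζ ω a b c ≠ 0 := by
  unfold cellPhase
  split_ifs <;> exact mul_ne_zero (zpow_ne_zero _ hζ) (zpow_ne_zero _ hω)

/-- A step along a fixed edge direction is an involution of the vertices, so it can serve as a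
change of summation variable; the plane wave then contributes its edge phase. -/
theorem floquetTransform_comp_hexStep {ζ ω : ℂ} (hζ : ζ ≠ 0) (hω : ω ≠ 0) (a b : ℤ)
    (ψ : HexVertex → ℂ) (c : HexCell) :
    floquetTransform ζ ω (fun u => ψ (hexStep a b u)) c =
      cellPhase ζ ω a b c * floquetTransform ζ ω ψ (cellStep a b c) := by
  unfold floquetTransform
  rw [← (hexStep a b).tsum_eq, ← tsum_mul_left]
  refine tsum_congr fun u => ?_
  have hiff : hexCellOf (hexStep a b u) = c ↔ hexCellOf u = cellStep a b c := by
    rw [hexCellOf_hexStep]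
    constructor
    · rintro rfl; rw [cellStep_cellStep]
    · intro h; rw [h, cellStep_cellStep]
  simp only [hexStep_hexStep]
  by_cases h : hexCellOf u = cellStep a b c
  · rw [if_pos h, if_pos (hiff.mpr h)]
    have h1 := planeWave_hexStep hζ hω a b (hexStep a b u)
    rw [hexStep_hexStep, hiff.mpr h] at h1
    have := planeWave_ne_zero hζ hω (hexStep a b u)
    have := cellPhase_ne_zero hζ hω a b c
    rw [h1]
    field_simp
  · rw [if_neg h, if_neg (fun h' => h (hiff.mp h')), mul_zero]

theorem summable_floquetTransform {ψ : HexVertex → ℂ} (hψ : ψ.support.Finite) (ζ ω : ℂ)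
    (c : HexCell) :
    Summable fun u => if hexCellOf u = c then (planeWave ζ ω u)⁻¹ * ψ u else 0 := by
  refine summable_of_hasFiniteSupport (hψ.subset fun u hu => ?_)
  intro h
  simp [h] at hu

theorem floquetTransform_hexSchrodinger {ζ ω : ℂ} (hζ : ζ ≠ 0) (hω : ω ≠ 0) (lam E : ℝ)
    (ψ : HilbertL2 HexVertex) (hψ : (ψ : HexVertex → ℂ).support.Finite) (c : HexCell) :
    floquetTransform ζ ω (hexSchrodinger lam ψ - (E : ℂ) • ψ : HilbertL2 HexVertex) c =
      blochHamiltonian lam ζ ω (floquetTransform ζ ω ψ) c - E * floquetTransform ζ ω ψ c := by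
  have hs : ∀ a b : ℤ, (fun u => ψ (hexStep a b u)).support.Finite := fun a b =>
    hψ.preimage (hexStep a b).injective.injOn
  unfold blochHamiltonian
  simp only [← floquetTransform_comp_hexStep hζ hω]
  unfold floquetTransform
  have h0 := summable_floquetTransform hψ ζ ω c
  have h1 := fun a b => summable_floquetTransform (hs a b) ζ ω c
  rw [← (h1 0 0).tsum_add (h1 0 1), ← ((h1 0 0).add (h1 0 1)).tsum_add (h1 1 0),
    ← tsum_mul_left, ← tsum_mul_left,
    ← (((h1 0 0).add (h1 0 1)).add (h1 1 0)).tsum_add ((h0.mul_left _).mul_left _),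
    ← tsum_mul_left,
    ← ((((h1 0 0).add (h1 0 1)).add (h1 1 0)).add ((h0.mul_left _).mul_left _)).tsum_sub
      (h0.mul_left _)]
  refine tsum_congr fun u => ?_
  have e1 : (hexSchrodinger lam ψ - (E : ℂ) • ψ : HilbertL2 HexVertex) u =
      hexSchrodinger lam ψ u - E * ψ u := rfl
  rw [e1, hexSchrodinger_apply, hexPotential_eq_cellPotential]
  by_cases h : hexCellOf u = c
  · subst h
    simp only [if_true]
    ring
  · simp only [if_neg h]
    ring

open UnitAddTorus in
theorem floquetTransform_eq_sum (ψ : HilbertL2 HexVertex)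
    (hψ : (ψ : HexVertex → ℂ).support.Finite) (c : HexCell) (t : UnitAddTorus (Fin 2)) :
    floquetTransform (fourier 1 (t 0)) (fourier 1 (t 1)) ψ c =
      ∑ u ∈ hψ.toFinset with hexCellOf u = c, ψ u * mFourier ![-u.1.1, -u.1.2] t := by
  unfold floquetTransform
  rw [tsum_eq_sum (s := hψ.toFinset), Finset.sum_filter]
  · refine Finset.sum_congr rfl fun u _ => ?_
    split_ifs
    · have e : ∀ (n : ℤ) (x : UnitAddCircle), ((fourier 1 x : ℂ) ^ n)⁻¹ = fourier (-n) x := by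
        intro n x
        rw [← zpow_neg]
        simp only [fourier_apply, one_smul, AddCircle.toCircle_zsmul]
        simp
      rw [planeWave, mul_inv, e, e, mul_comm]
      simp [mFourier]
    · rfl
  · intro u hu
    have : ψ u = 0 := by simpa using hu
    simp [this]

theorem integrable_floquetTransform_apply (ψ : HilbertL2 HexVertex)
    (hψ : (ψ : HexVertex → ℂ).support.Finite) (c : HexCell) :
    MeasureTheory.Integrable (fun t : UnitAddTorus (Fin 2) =>
      ‖floquetTransform (fourier 1 (t 0)) (fourier 1 (t 1)) ψ c‖ ^ 2) (torusMeasure (Fin 2)) := by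
  simp only [floquetTransform_eq_sum ψ hψ]
  exact Continuous.integrable_of_hasCompactSupport (by fun_prop)
    (HasCompactSupport.of_compactSpace _)

theorem integrable_floquetTransform (ψ : HilbertL2 HexVertex)
    (hψ : (ψ : HexVertex → ℂ).support.Finite) :
    MeasureTheory.Integrable (fun t : UnitAddTorus (Fin 2) =>
      ∑ c, ‖floquetTransform (fourier 1 (t 0)) (fourier 1 (t 1)) ψ c‖ ^ 2)
      (torusMeasure (Fin 2)) :=
  MeasureTheory.integrable_finsetSum _ fun c _ => integrable_floquetTransform_apply ψ hψ c

open UnitAddTorus in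
/-- Parseval's identity for the Floquet transform. -/
theorem integral_floquetTransform (ψ : HilbertL2 HexVertex)
    (hψ : (ψ : HexVertex → ℂ).support.Finite) :
    ∫ t, ∑ c, ‖floquetTransform (fourier 1 (t 0)) (fourier 1 (t 1)) ψ c‖ ^ 2
      ∂torusMeasure (Fin 2) = ‖ψ‖ ^ 2 := by
  rw [MeasureTheory.integral_finsetSum _ fun c _ => integrable_floquetTransform_apply ψ hψ c]
  have h1 : ∀ c, ∫ t, ‖floquetTransform (fourier 1 (t 0)) (fourier 1 (t 1)) ψ c‖ ^ 2
      ∂torusMeasure (Fin 2) =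
        ∑ u ∈ hψ.toFinset with hexCellOf u = c, ‖ψ u‖ ^ 2 := fun c => by
    simp only [floquetTransform_eq_sum ψ hψ]
    refine integral_norm_sq_sum_mFourier _ (fun u : HexVertex => ![-u.1.1, -u.1.2]) ?_ _
    -- Within one class the sublattice is fixed, so the frequency, which records only the two
    -- integer labels, determines the vertex.
    intro u hu v hv huv
    have hu2 := congrArg Prod.snd (Finset.mem_filter.mp hu).2
    have hv2 := congrArg Prod.snd (Finset.mem_filter.mp hv).2
    have h0 := congrFun huv 0
    have h1 := congrFun huv 1
    simp at h0 h1
    exact Prod.ext (Prod.ext h0 h1) (hu2.trans hv2.symm)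
  rw [Finset.sum_congr rfl fun c _ => h1 c, Finset.sum_fiberwise]
  have h2 := lp.norm_rpow_eq_tsum (p := 2) (by simp) ψ
  simp only [ENNReal.toReal_ofNat, Real.rpow_ofNat] at h2
  rw [h2, tsum_eq_sum]
  intro u hu
  have : ψ u = 0 := by simpa using hu
  simp [this]

/-! ### Points outside all Bloch spectra are outside the spectrum -/

theorem continuous_blochHamiltonian (lam : ℝ) (c : HexCell) :
    Continuous fun p : (Circle × Circle) × (HexCell → ℂ) =>
      blochHamiltonian lam p.1.1 p.1.2 p.2 c := by
  have hz : ∀ n : ℤ, Continuous fun p : (Circle × Circle) × (HexCell → ℂ) => (p.1.1 : ℂ) ^ n :=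
    fun n => (continuous_subtype_val.comp (continuous_fst.comp continuous_fst)).zpow₀ n
      fun p => Or.inl (Circle.coe_ne_zero p.1.1)
  have hw : ∀ n : ℤ, Continuous fun p : (Circle × Circle) × (HexCell → ℂ) => (p.1.2 : ℂ) ^ n :=
    fun n => (continuous_subtype_val.comp (continuous_snd.comp continuous_fst)).zpow₀ n
      fun p => Or.inl (Circle.coe_ne_zero p.1.2)
  have hp : ∀ a b : ℤ, Continuous fun p : (Circle × Circle) × (HexCell → ℂ) =>
      cellPhase p.1.1 p.1.2 a b c := fun a b => by
    unfold cellPhase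
    split_ifs
    · exact (hz _).mul (hw _)
    · exact (hz _).mul (hw _)
  have hf : ∀ c' : HexCell, Continuous fun p : (Circle × Circle) × (HexCell → ℂ) => p.2 c' :=
    fun c' => (continuous_apply c').comp continuous_snd
  unfold blochHamiltonian
  exact ((((hp 0 0).mul (hf _)).add ((hp 0 1).mul (hf _))).add ((hp 1 0).mul (hf _))).add
    (continuous_const.mul (continuous_const.mul (hf _)))

theorem blochHamiltonian_smul (lam : ℝ) (ζ ω a : ℂ) (φ : HexCell → ℂ) (c : HexCell) :
    blochHamiltonian lam ζ ω (a • φ) c = a * blochHamiltonian lam ζ ω φ c := by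
  simp only [blochHamiltonian, Pi.smul_apply, smul_eq_mul]
  ring

/-- If no Bloch Hamiltonian has the eigenvalue `E`, then they are uniformly bounded below. -/
theorem exists_blochHamiltonian_bounded_below {lam E : ℝ}
    (h : ∀ (ζ ω : Circle) (φ : HexCell → ℂ),
      blochHamiltonian lam ζ ω φ = (fun c => E * φ c) → φ = 0) :
    ∃ δ > 0, ∀ (ζ ω : Circle) (φ : HexCell → ℂ),
      δ * ∑ c, ‖φ c‖ ^ 2 ≤ ∑ c, ‖blochHamiltonian lam ζ ω φ c - E * φ c‖ ^ 2 := by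
  set G : (Circle × Circle) × (HexCell → ℂ) → ℝ := fun p =>
    ∑ c, ‖blochHamiltonian lam p.1.1 p.1.2 p.2 c - E * p.2 c‖ ^ 2 with hG
  have hGc : Continuous G := continuous_finsetSum _ fun c _ =>
    (((continuous_blochHamiltonian lam c).sub
      (continuous_const.mul ((continuous_apply c).comp continuous_snd))).norm).pow 2
  -- Parseval needs the Euclidean sphere, while `HexCell → ℂ` carries the sup norm; compactness
  -- follows since this sphere is a closed subset of the unit sup-ball.
  set S : Set (HexCell → ℂ) := {φ | ∑ c, ‖φ c‖ ^ 2 = 1} with hS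
  have hSc : IsCompact S := by
    refine (isCompact_closedBall (0 : HexCell → ℂ) 1).of_isClosed_subset
      (isClosed_eq (by fun_prop) continuous_const) fun φ hφ => ?_
    rw [mem_closedBall_zero_iff, pi_norm_le_iff_of_nonneg zero_le_one]
    intro c
    have h1 : ‖φ c‖ ^ 2 ≤ ∑ c, ‖φ c‖ ^ 2 :=
      Finset.single_le_sum (f := fun c => ‖φ c‖ ^ 2) (fun _ _ => by positivity) (Finset.mem_univ c)
    rw [hφ] at h1
    exact (sq_le_one_iff₀ (norm_nonneg _)).mp h1
  have hSne : S.Nonempty :=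
    ⟨Pi.single ((0, 0), false) 1, by
      rw [hS, Set.mem_ofPred_eq, Finset.sum_eq_single ((0, 0), false)]
      · simp
      · intro b _ hb
        simp [hb]
      · simp⟩
  obtain ⟨p, hp, hmin⟩ := ((isCompact_univ (X := Circle × Circle)).prod hSc).exists_isMinOn
    (Set.univ_nonempty.prod hSne) hGc.continuousOn
  have hsum0 : ∀ φ : HexCell → ℂ, ∑ c, ‖φ c‖ ^ 2 = 0 → φ = 0 := fun φ h0 => by
    rw [Finset.sum_eq_zero_iff_of_nonneg fun _ _ => by positivity] at h0
    ext c
    simpa using h0 c (Finset.mem_univ c)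
  have hpos : 0 < G p := by
    refine lt_of_le_of_ne (Finset.sum_nonneg fun _ _ => by positivity) fun h0 => ?_
    have h1 := hsum0 _ h0.symm
    have h2 := h p.1.1 p.1.2 p.2 (funext fun c => sub_eq_zero.mp (congrFun h1 c))
    have h3 : ∑ c, ‖p.2 c‖ ^ 2 = 1 := hp.2
    rw [h2] at h3
    simp at h3
  refine ⟨G p, hpos, fun ζ ω φ => ?_⟩
  set N := ∑ c, ‖φ c‖ ^ 2 with hN
  have hN0 : 0 ≤ N := Finset.sum_nonneg fun _ _ => by positivity
  rcases hN0.eq_or_lt with h0 | h0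
  · rw [← h0, mul_zero]
    exact Finset.sum_nonneg fun _ _ => by positivity
  · set a : ℝ := (√N)⁻¹ with ha
    have ha2 : a ^ 2 * N = 1 := by
      rw [ha, inv_pow, Real.sq_sqrt hN0, inv_mul_cancel₀ h0.ne']
    have hmem : ((ζ, ω), (a : ℂ) • φ) ∈ (Set.univ : Set (Circle × Circle)) ×ˢ S := by
      refine ⟨Set.mem_univ _, ?_⟩
      rw [hS, Set.mem_ofPred_eq, ← ha2, hN, Finset.mul_sum]
      exact Finset.sum_congr rfl fun c _ => by simp [mul_pow]
    have h1 : G p ≤ a ^ 2 * ∑ c, ‖blochHamiltonian lam ζ ω φ c - E * φ c‖ ^ 2 := by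
      refine (hmin hmem).trans_eq ?_
      rw [hG, Finset.mul_sum]
      refine Finset.sum_congr rfl fun c _ => ?_
      have e : blochHamiltonian lam ζ ω ((a : ℂ) • φ) c - E * ((a : ℂ) • φ) c =
          a * (blochHamiltonian lam ζ ω φ c - E * φ c) := by
        rw [blochHamiltonian_smul, Pi.smul_apply, smul_eq_mul]
        ring
      simp only [e, norm_mul, mul_pow, Complex.norm_real, Real.norm_eq_abs, sq_abs]
    calc G p * N ≤ a ^ 2 * (∑ c, ‖blochHamiltonian lam ζ ω φ c - E * φ c‖ ^ 2) * N := by gcongr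
      _ = a ^ 2 * N * ∑ c, ‖blochHamiltonian lam ζ ω φ c - E * φ c‖ ^ 2 := by ring
      _ = _ := by rw [ha2, one_mul]

theorem support_finite_hexSchrodinger_sub {lam E : ℝ} {ψ : HilbertL2 HexVertex}
    (hψ : (ψ : HexVertex → ℂ).support.Finite) :
    ((hexSchrodinger lam ψ - (E : ℂ) • ψ : HilbertL2 HexVertex) : HexVertex → ℂ).support.Finite := by
  have hs : ∀ a b : ℤ, (fun u => ψ (hexStep a b u)).support.Finite := fun a b =>
    hψ.preimage (hexStep a b).injective.injOn
  refine ((((hs 0 0).union (hs 0 1)).union (hs 1 0)).union hψ).subset fun u hu => ?_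
  by_contra h
  simp only [Set.mem_union, Function.mem_support, not_or, not_not] at h
  obtain ⟨⟨⟨h1, h2⟩, h3⟩, h4⟩ := h
  refine hu ?_
  change hexSchrodinger lam ψ u - E * ψ u = 0
  rw [hexSchrodinger_apply, h1, h2, h3, h4]
  ring

/-- The uniform fibrewise bound `δ` is integrated over the torus: Parseval gives the lower bound
`√δ` on finitely supported vectors, and density with continuity extends it to `ℓ²`. -/
theorem notMem_hexSpectrum_of_blochHamiltonian {lam E : ℝ}
    (h : ∀ (ζ ω : Circle) (φ : HexCell → ℂ),
      blochHamiltonian lam ζ ω φ = (fun c => E * φ c) → φ = 0) : E ∉ hexSpectrum lam := by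
  obtain ⟨δ, hδ, hb⟩ := exists_blochHamiltonian_bounded_below h
  have hfin : ∀ ψ : HilbertL2 HexVertex, (ψ : HexVertex → ℂ).support.Finite →
      √δ * ‖ψ‖ ≤ ‖hexSchrodinger lam ψ - (E : ℂ) • ψ‖ := fun ψ hψ => by
    refine le_of_sq_le_sq ?_ (norm_nonneg _)
    rw [mul_pow, Real.sq_sqrt hδ.le, ← integral_floquetTransform ψ hψ,
      ← integral_floquetTransform _ (support_finite_hexSchrodinger_sub hψ),
      ← MeasureTheory.integral_const_mul]
    refine MeasureTheory.integral_mono ?_ ?_ fun t => ?_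
    · exact (integrable_floquetTransform ψ hψ).const_mul _
    · exact integrable_floquetTransform _ (support_finite_hexSchrodinger_sub hψ)
    · have h1 := hb (AddCircle.toCircle (t 0)) (AddCircle.toCircle (t 1))
        (floquetTransform (fourier 1 (t 0)) (fourier 1 (t 1)) ψ)
      simp only [fourier_one] at h1 ⊢
      simp only [floquetTransform_hexSchrodinger (Circle.coe_ne_zero _) (Circle.coe_ne_zero _) lam E
        ψ hψ]
      exact h1
  refine notMem_hexSpectrum_of_bounded_below (Real.sqrt_pos.mpr hδ) fun ψ => ?_
  have hlim := lp.hasSum_single (p := 2) (by simp) ψ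
  have hcont : Continuous fun ψ : HilbertL2 HexVertex =>
      ‖hexSchrodinger lam ψ - (E : ℂ) • ψ‖ - √δ * ‖ψ‖ := by fun_prop
  have h0 := ge_of_tendsto ((hcont.tendsto ψ).comp hlim) (b := 0)
    (Filter.Eventually.of_forall fun s => ?_)
  · linarith
  · refine sub_nonneg.mpr (hfin _ (s.finite_toSet.subset fun u hu => ?_))
    by_contra hus
    refine hu ?_
    rw [lp.coeFn_sum, Finset.sum_apply]
    refine Finset.sum_eq_zero fun v hv => ?_
    rw [lp.single_apply_ne]
    rintro rfl
    exact hus hv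

/-! ### The Bloch determinant -/

/-- The determinant of the Bloch Hamiltonian minus the energy, as a function of `x = E² - 1`,
`l = λ²`, `m = ∑ (1 - cos)` and `k = ∏ (1 - cos)`, where the cosines are those of the three
quasimomenta. -/
def bandDet {R : Type*} [CommRing R] (x l m k : R) : R :=
  (x - l) ^ 2 * (x ^ 2 - 8 * x - 5 * l * x - l + 4 * l ^ 2) +
    4 * m * (x + 2 * l) * (x - l) - 8 * k

/-- The off-diagonal block of the Bloch Hamiltonian. -/
def bipartiteBlock (ζ ω : ℂ) : Matrix (Fin 4) (Fin 4) ℂ :=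
  !![1, ζ, ω, 0; ζ, 1, 0, ω; ω, 0, 1, ζ; 0, ω, ζ, 1]

/-- The Bloch Hamiltonian minus the energy as a matrix. -/
noncomputable def blochMatrix (lam E ζ ω : ℂ) : Matrix (Fin 4 ⊕ Fin 4) (Fin 4 ⊕ Fin 4) ℂ :=
  Matrix.fromBlocks (Matrix.diagonal ![lam - E, lam - E, -2 * lam - E, lam - E])
    (bipartiteBlock ζ⁻¹ ω⁻¹) (bipartiteBlock ζ ω)
    (Matrix.diagonal ![-lam - E, 2 * lam - E, -lam - E, -lam - E])

theorem det_four {R : Type*} [CommRing R]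
    (a₀ a₁ a₂ a₃ b₀ b₁ b₂ b₃ c₀ c₁ c₂ c₃ d₀ d₁ d₂ d₃ : R) :
    !![a₀, a₁, a₂, a₃; b₀, b₁, b₂, b₃; c₀, c₁, c₂, c₃; d₀, d₁, d₂, d₃].det =
      a₀ * (b₁ * (c₂ * d₃ - c₃ * d₂) - b₂ * (c₁ * d₃ - c₃ * d₁) + b₃ * (c₁ * d₂ - c₂ * d₁)) -
      a₁ * (b₀ * (c₂ * d₃ - c₃ * d₂) - b₂ * (c₀ * d₃ - c₃ * d₀) + b₃ * (c₀ * d₂ - c₂ * d₀)) +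
      a₂ * (b₀ * (c₁ * d₃ - c₃ * d₁) - b₁ * (c₀ * d₃ - c₃ * d₀) + b₃ * (c₀ * d₁ - c₁ * d₀)) -
      a₃ * (b₀ * (c₁ * d₂ - c₂ * d₁) - b₁ * (c₀ * d₂ - c₂ * d₀) + b₂ * (c₀ * d₁ - c₁ * d₀)) := by
  rw [Matrix.det_succ_row_zero, Fin.sum_univ_four]
  simp [Matrix.det_fin_three, Fin.succAbove]
  ring

-- The hypotheses make the diagonal block of the second sublattice invertible, so its Schur
-- complement reduces the 8×8 determinant to a 4×4 one.
set_option maxRecDepth 10000 in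
set_option maxHeartbeats 4000000 in
theorem det_blochMatrix_of_ne {lam E ζ ω : ℂ} (hζ : ζ ≠ 0) (hω : ω ≠ 0) (h1 : -lam - E ≠ 0)
    (h2 : 2 * lam - E ≠ 0) :
    (blochMatrix lam E ζ ω).det = bandDet (E ^ 2 - 1) (lam ^ 2)
      (3 - (ζ ^ 2 + (ζ ^ 2)⁻¹ + ω ^ 2 + (ω ^ 2)⁻¹ + ζ ^ 2 * (ω ^ 2)⁻¹ + ω ^ 2 * (ζ ^ 2)⁻¹) / 2)
      ((1 - (ζ ^ 2 + (ζ ^ 2)⁻¹) / 2) * (1 - (ω ^ 2 + (ω ^ 2)⁻¹) / 2) *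
        (1 - (ζ ^ 2 * (ω ^ 2)⁻¹ + ω ^ 2 * (ζ ^ 2)⁻¹) / 2)) := by
  set b : Fin 4 → ℂ := ![-lam - E, 2 * lam - E, -lam - E, -lam - E] with hb
  have hb0 : ∀ i, b i ≠ 0 := by intro i; fin_cases i <;> simp [hb, h1, h2]
  have hinv : Matrix.diagonal b⁻¹ * Matrix.diagonal b = 1 := by
    rw [Matrix.diagonal_mul_diagonal, ← Matrix.diagonal_one]
    congr 1
    ext i
    simp [hb0 i]
  let _ : Invertible (Matrix.diagonal b) := ⟨Matrix.diagonal b⁻¹, hinv, by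
    rw [mul_eq_one_comm, hinv]⟩
  have hS : Matrix.diagonal ![lam - E, lam - E, -2 * lam - E, lam - E] -
      bipartiteBlock ζ⁻¹ ω⁻¹ * Matrix.diagonal b⁻¹ * bipartiteBlock ζ ω =
      let κ := (-lam - E)⁻¹
      let μ := (2 * lam - E)⁻¹
      !![lam - E - (2 * κ + μ), -(κ * ζ + μ * ζ⁻¹), -(κ * ω + κ * ω⁻¹),
          -(ζ⁻¹ * ω * μ + ω⁻¹ * ζ * κ);
        -(κ * ζ⁻¹ + μ * ζ), lam - E - (2 * κ + μ), -(ζ⁻¹ * ω * κ + ω⁻¹ * ζ * κ),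
          -(μ * ω + κ * ω⁻¹);
        -(κ * ω + κ * ω⁻¹), -(ζ * ω⁻¹ * κ + ω * ζ⁻¹ * κ), -2 * lam - E - 3 * κ,
          -(κ * ζ + κ * ζ⁻¹);
        -(ζ * ω⁻¹ * μ + ω * ζ⁻¹ * κ), -(μ * ω⁻¹ + κ * ω), -(κ * ζ + κ * ζ⁻¹),
          lam - E - (2 * κ + μ)] := by
    ext i j
    rw [Matrix.sub_apply, Matrix.mul_apply]
    simp only [Matrix.mul_diagonal, Fin.sum_univ_four, Matrix.diagonal_apply]
    fin_cases i <;> fin_cases j <;> simp [bipartiteBlock, hb] <;> field_simp <;> ring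
  have hdb : (Matrix.diagonal b).det = (-lam - E) ^ 3 * (2 * lam - E) := by
    rw [Matrix.det_diagonal, Fin.prod_univ_four]
    simp [hb]
    ring
  rw [blochMatrix, Matrix.det_fromBlocks₂₂, hdb]
  change _ * (_ - _ * Matrix.diagonal b⁻¹ * _).det = _
  rw [hS]
  -- With the two distinct diagonal entries `p` and `q` as variables in place of `λ` and `E`, the
  -- denominators are monomials and a polynomial identity remains.
  obtain ⟨p, hp⟩ : ∃ p, -lam - E = p := ⟨_, rfl⟩
  obtain ⟨q, hq⟩ : ∃ q, 2 * lam - E = q := ⟨_, rfl⟩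
  rw [hp] at h1
  rw [hq] at h2
  rw [hp, hq, det_four]
  have hl : lam = (q - p) / 3 := by linear_combination (hq - hp) / 3
  have hE : E = -(q + 2 * p) / 3 := by linear_combination (-hq - 2 * hp) / 3
  rw [hl, hE]
  simp only [bandDet]
  field_simp
  ring

/-- Both sides are continuous in `E`, and the Schur complement computation excludes at most two
values of `E`, so density removes the exception. -/
theorem det_blochMatrix {lam E ζ ω : ℂ} (hζ : ζ ≠ 0) (hω : ω ≠ 0) :
    (blochMatrix lam E ζ ω).det = bandDet (E ^ 2 - 1) (lam ^ 2)
      (3 - (ζ ^ 2 + (ζ ^ 2)⁻¹ + ω ^ 2 + (ω ^ 2)⁻¹ + ζ ^ 2 * (ω ^ 2)⁻¹ + ω ^ 2 * (ζ ^ 2)⁻¹) / 2)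
      ((1 - (ζ ^ 2 + (ζ ^ 2)⁻¹) / 2) * (1 - (ω ^ 2 + (ω ^ 2)⁻¹) / 2) *
        (1 - (ζ ^ 2 * (ω ^ 2)⁻¹ + ω ^ 2 * (ζ ^ 2)⁻¹) / 2)) := by
  have hd : Dense ({-lam, 2 * lam} : Set ℂ)ᶜ := (Set.toFinite _).countable.dense_compl ℂ
  have hc : Continuous fun E => (blochMatrix lam E ζ ω).det := by
    refine Continuous.matrix_det
      (Continuous.matrix_fromBlocks ?_ continuous_const continuous_const ?_)
    all_goals
      refine Continuous.matrix_diagonal (continuous_pi fun i => ?_)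
      fin_cases i <;> simp <;> fun_prop
  refine congrFun (hc.ext_on hd (g := fun E => bandDet (E ^ 2 - 1) (lam ^ 2) _ _) ?_
    fun E hE => ?_) E
  · unfold bandDet
    fun_prop
  · simp only [Set.mem_compl_iff, Set.mem_insert_iff, Set.mem_singleton_iff, not_or] at hE
    exact det_blochMatrix_of_ne hζ hω (fun h => hE.1 (by linear_combination -h))
      fun h => hE.2 (by linear_combination -h)

/-- The enumeration of the classes of vertices, one sublattice after the other. -/
def cellEnum : Fin 4 ⊕ Fin 4 → HexCell :=
  Sum.elim (fun i => (![(0, 0), (1, 0), (0, 1), (1, 1)] i, false))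
    (fun i => (![(0, 0), (1, 0), (0, 1), (1, 1)] i, true))

theorem bijective_cellEnum : Function.Bijective cellEnum := by
  decide

theorem blochMatrix_mulVec (lam E : ℝ) (ζ ω : ℂ) (φ : HexCell → ℂ) (i : Fin 4 ⊕ Fin 4) :
    (blochMatrix lam E ζ ω).mulVec (φ ∘ cellEnum) i =
      blochHamiltonian lam ζ ω φ (cellEnum i) - E * φ (cellEnum i) := by
  have h11 : (1 + 1 : ZMod 2) = 0 := by decide
  have h12 : (-1 : ZMod 2) = 1 := by decide
  rcases i with i | i <;> fin_cases i <;>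
    simp [blochMatrix, Matrix.mulVec, dotProduct, Fin.sum_univ_four, bipartiteBlock, cellEnum,
      blochHamiltonian, cellPhase, cellStep, cellPotential, Matrix.diagonal_apply, h11, h12] <;>
    ring

theorem exists_blochHamiltonian_eigen_iff {lam E : ℝ} {ζ ω : ℂ} :
    (∃ φ : HexCell → ℂ, φ ≠ 0 ∧ blochHamiltonian lam ζ ω φ = fun c => E * φ c) ↔
      (blochMatrix lam E ζ ω).det = 0 := by
  rw [← Matrix.exists_mulVec_eq_zero_iff]
  set e := Equiv.ofBijective _ bijective_cellEnum
  constructor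
  · rintro ⟨φ, hφ0, hφ⟩
    refine ⟨φ ∘ cellEnum, fun h => hφ0 ?_, ?_⟩
    · ext c
      obtain ⟨i, rfl⟩ := bijective_cellEnum.surjective c
      exact congrFun h i
    · ext i
      rw [blochMatrix_mulVec, hφ]
      simp
  · rintro ⟨x, hx0, hx⟩
    have hxe : x = (x ∘ e.symm) ∘ cellEnum := by
      ext i
      exact congrArg x (e.symm_apply_apply i).symm
    refine ⟨x ∘ e.symm, fun h => hx0 ?_, ?_⟩
    · rw [hxe, h]
      rfl
    · ext c
      obtain ⟨i, rfl⟩ := bijective_cellEnum.surjective c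
      have := blochMatrix_mulVec lam E ζ ω (x ∘ e.symm) i
      rw [← hxe, hx] at this
      exact sub_eq_zero.mp this.symm

/-! ### Quasimomenta as real angles -/

/-- `∑ (1 - cos)` over the three quasimomenta `A`, `B`, `A - B`. -/
noncomputable def cosSum (A B : ℝ) : ℝ :=
  (1 - Real.cos A) + (1 - Real.cos B) + (1 - Real.cos (A - B))

/-- `∏ (1 - cos)` over the three quasimomenta `A`, `B`, `A - B`. -/
noncomputable def cosProd (A B : ℝ) : ℝ :=
  (1 - Real.cos A) * (1 - Real.cos B) * (1 - Real.cos (A - B))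

/-- Half angles appear because `ζ` and `ω` are the phases for `b₊` and `b₋`, while the periods are
`2 b₊` and `2 b₋`, whose phases are `exp(iA)` and `exp(iB)`. -/
theorem det_blochMatrix_exp (lam E A B : ℝ) :
    (blochMatrix lam E (Complex.exp ((A / 2 : ℝ) * Complex.I))
      (Complex.exp ((B / 2 : ℝ) * Complex.I))).det =
      (bandDet (E ^ 2 - 1) (lam ^ 2) (cosSum A B) (cosProd A B) : ℝ) := by
  rw [det_blochMatrix (Complex.exp_ne_zero _) (Complex.exp_ne_zero _)]
  have hsq : ∀ t : ℝ, Complex.exp ((t / 2 : ℝ) * Complex.I) ^ 2 = Complex.exp (t * Complex.I) :=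
    fun t => by
      rw [← Complex.exp_nat_mul]
      congr 1
      push_cast
      ring
  have hcos : ∀ t : ℝ, ((Real.cos t : ℝ) : ℂ) =
      (Complex.exp (t * Complex.I) + (Complex.exp (t * Complex.I))⁻¹) / 2 := fun t => by
    rw [Complex.ofReal_cos, Complex.cos, ← Complex.exp_neg, neg_mul]
  have hdiff : Complex.exp (((A : ℂ) - B) * Complex.I) =
      Complex.exp (A * Complex.I) * (Complex.exp (B * Complex.I))⁻¹ := by
    rw [← Complex.exp_neg, ← Complex.exp_add]
    congr 1
    ring
  rw [hsq, hsq]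
  have hm : ((cosSum A B : ℝ) : ℂ) = 3 - (Complex.exp (A * Complex.I) +
      (Complex.exp (A * Complex.I))⁻¹ + Complex.exp (B * Complex.I) +
      (Complex.exp (B * Complex.I))⁻¹ +
      Complex.exp (A * Complex.I) * (Complex.exp (B * Complex.I))⁻¹ +
      Complex.exp (B * Complex.I) * (Complex.exp (A * Complex.I))⁻¹) / 2 := by
    simp only [cosSum, Complex.ofReal_add, Complex.ofReal_sub, Complex.ofReal_one, hcos, hdiff,
      mul_inv, inv_inv]
    ring
  have hk : ((cosProd A B : ℝ) : ℂ) =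
      (1 - (Complex.exp (A * Complex.I) + (Complex.exp (A * Complex.I))⁻¹) / 2) *
        (1 - (Complex.exp (B * Complex.I) + (Complex.exp (B * Complex.I))⁻¹) / 2) *
        (1 - (Complex.exp (A * Complex.I) * (Complex.exp (B * Complex.I))⁻¹ +
          Complex.exp (B * Complex.I) * (Complex.exp (A * Complex.I))⁻¹) / 2) := by
    simp only [cosProd, Complex.ofReal_mul, Complex.ofReal_sub, Complex.ofReal_one, hcos, hdiff,
      mul_inv, inv_inv]
    ring
  rw [← hm, ← hk]
  simp only [bandDet]
  push_cast
  rfl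

/-- The spectrum is the set of the energies at which the determinant vanishes for some
quasimomentum. -/
theorem mem_hexSpectrum_iff {lam E : ℝ} :
    E ∈ hexSpectrum lam ↔
      ∃ A B : ℝ, bandDet (E ^ 2 - 1) (lam ^ 2) (cosSum A B) (cosProd A B) = 0 := by
  constructor
  · contrapose!
    intro h
    refine notMem_hexSpectrum_of_blochHamiltonian fun ζ ω φ hφ => ?_
    by_contra hφ0
    have h1 := exists_blochHamiltonian_eigen_iff.mp ⟨φ, hφ0, hφ⟩
    have harg : ∀ z : Circle, (z : ℂ) = Complex.exp ((2 * Complex.arg z / 2 : ℝ) * Complex.I) :=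
      fun z => by
        rw [mul_div_cancel_left₀ _ two_ne_zero]
        have hz := Complex.norm_mul_exp_arg_mul_I (z : ℂ)
        rw [Circle.norm_coe, Complex.ofReal_one, one_mul] at hz
        exact hz.symm
    rw [harg ζ, harg ω, det_blochMatrix_exp] at h1
    exact h _ _ (by exact_mod_cast h1)
  · rintro ⟨A, B, h⟩
    have h1 := det_blochMatrix_exp lam E A B
    rw [h, Complex.ofReal_zero] at h1
    obtain ⟨φ, hφ0, hφ⟩ := exists_blochHamiltonian_eigen_iff.mpr h1
    exact mem_hexSpectrum_of_blochHamiltonian (Complex.norm_exp_ofReal_mul_I _)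
      (Complex.norm_exp_ofReal_mul_I _) hφ0 hφ

/-! ### Inequalities between the two functions of the quasimomentum -/

theorem cosSum_nonneg (A B : ℝ) : 0 ≤ cosSum A B := by
  unfold cosSum
  linarith [Real.cos_le_one A, Real.cos_le_one B, Real.cos_le_one (A - B)]

theorem cosProd_nonneg (A B : ℝ) : 0 ≤ cosProd A B :=
  mul_nonneg (mul_nonneg (sub_nonneg.mpr (Real.cos_le_one A)) (sub_nonneg.mpr (Real.cos_le_one B)))
    (sub_nonneg.mpr (Real.cos_le_one _))

/-- This is `|1 + exp(iA) + exp(iB)|² ≥ 0`, with equality at the Dirac points. -/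
theorem cosSum_le (A B : ℝ) : cosSum A B ≤ 9 / 2 := by
  unfold cosSum
  rw [Real.cos_sub]
  nlinarith [sq_nonneg (1 + Real.cos A + Real.cos B), sq_nonneg (Real.sin A + Real.sin B),
    Real.sin_sq_add_cos_sq A, Real.sin_sq_add_cos_sq B]

/-- Each factor `1 - cos` lies in `[0, 2]`, so the product is at most four times each factor; the
three bounds are added. -/
theorem three_mul_cosProd_le (A B : ℝ) : 3 * cosProd A B ≤ 4 * cosSum A B := by
  have key : ∀ p q r : ℝ, 0 ≤ p → 0 ≤ q → 0 ≤ r → p ≤ 2 → q ≤ 2 → p * q * r ≤ 4 * r :=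
    fun p q r hp hq hr hp2 hq2 => by
      have : p * q ≤ 2 * 2 := mul_le_mul hp2 hq2 hq (by norm_num)
      nlinarith
  unfold cosSum cosProd
  have h : ∀ t : ℝ, 0 ≤ 1 - Real.cos t ∧ 1 - Real.cos t ≤ 2 := fun t =>
    ⟨by linarith [Real.cos_le_one t], by linarith [Real.neg_one_le_cos t]⟩
  obtain ⟨h1, h1'⟩ := h A
  obtain ⟨h2, h2'⟩ := h B
  obtain ⟨h3, h3'⟩ := h (A - B)
  have k1 := key _ _ _ h1 h2 h3 h1' h2'
  have k2 := key _ _ _ h1 h3 h2 h1' h3'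
  have k3 := key _ _ _ h2 h3 h1 h2' h3'
  linarith

/-- With `z = exp(iA)` and `w = exp(iB)`, the difference of the two sides is `|1 + z² + w² - 2zw -
2z - 2w|²`. This is the squared modulus of the determinant of the off-diagonal block, that is, the
Bloch determinant at `E = λ = 0`. -/
theorem cosProd_le (A B : ℝ) : 8 * cosProd A B ≤ 9 + 4 * cosSum A B := by
  unfold cosSum cosProd
  rw [Real.cos_sub]
  have h1 := Real.sin_sq_add_cos_sq A
  have h2 := Real.sin_sq_add_cos_sq B
  set a := Real.cos A
  set b := Real.cos B
  set s := Real.sin A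
  set t := Real.sin B
  have key : 9 + 4 * (1 - a + (1 - b) + (1 - (a * b + s * t))) -
      8 * ((1 - a) * (1 - b) * (1 - (a * b + s * t))) =
      (a * a - s * s + b * b - t * t + 1 - 2 * (a * b - s * t) - 2 * a - 2 * b) ^ 2 +
        (2 * a * s + 2 * b * t - 2 * (a * t + b * s) - 2 * s - 2 * t) ^ 2 := by
    linear_combination (-a ^ 2 - s ^ 2 - 2 * b ^ 2 - 6 * t ^ 2 - 3 + 4 * a * b + 4 * s * t +
      4 * a - 12 * b) * h1 + (4 * a ^ 2 - b ^ 2 - t ^ 2 - 9 + 4 * a * b + 4 * s * t - 12 * a +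
      4 * b) * h2
  nlinarith [sq_nonneg (a * a - s * s + b * b - t * t + 1 - 2 * (a * b - s * t) - 2 * a - 2 * b),
    sq_nonneg (2 * a * s + 2 * b * t - 2 * (a * t + b * s) - 2 * s - 2 * t)]

theorem cosSum_cosProd_zero : cosSum 0 0 = 0 ∧ cosProd 0 0 = 0 := by
  simp [cosSum, cosProd]

theorem cosSum_cosProd_pi : cosSum 0 Real.pi = 4 ∧ cosProd 0 Real.pi = 0 := by
  norm_num [cosSum, cosProd]

theorem cosSum_cosProd_dirac : cosSum (2 * Real.pi / 3) (-(2 * Real.pi / 3)) = 9 / 2 ∧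
    cosProd (2 * Real.pi / 3) (-(2 * Real.pi / 3)) = 27 / 8 := by
  have h1 : Real.cos (2 * Real.pi / 3) = -(1 / 2) := by
    rw [show 2 * Real.pi / 3 = Real.pi - Real.pi / 3 by ring, Real.cos_pi_sub, Real.cos_pi_div_three]
  have h2 : Real.cos (2 * Real.pi / 3 - -(2 * Real.pi / 3)) = -(1 / 2) := by
    rw [show 2 * Real.pi / 3 - -(2 * Real.pi / 3) = Real.pi / 3 + Real.pi by ring, Real.cos_add_pi,
      Real.cos_pi_div_three]
  unfold cosSum cosProd
  rw [Real.cos_neg, h1, h2]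
  norm_num

/-! ### Band edges and the bands between them -/

theorem exists_bandDet_eq_zero {x l A B A' B' : ℝ}
    (h : bandDet x l (cosSum A B) (cosProd A B) ≤ 0)
    (h' : 0 ≤ bandDet x l (cosSum A' B') (cosProd A' B')) :
    ∃ A B : ℝ, bandDet x l (cosSum A B) (cosProd A B) = 0 := by
  have hc : Continuous fun p : ℝ × ℝ => bandDet x l (cosSum p.1 p.2) (cosProd p.1 p.2) := by
    unfold bandDet cosSum cosProd
    fun_prop
  obtain ⟨p, hp⟩ := mem_range_of_exists_le_of_exists_ge hc ⟨(A, B), h⟩ ⟨(A', B'), h'⟩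
  exact ⟨p.1, p.2, hp⟩

/-- The determinant at the Dirac points, as a function of the square of the energy. -/
theorem bandDet_dirac (F l : ℝ) : bandDet (F - 1) l (9 / 2) (27 / 8) =
    F * (F - 4) ^ 3 + l * (4 - 33 * F + 36 * F ^ 2 - 7 * F ^ 3) +
      l ^ 2 * (-15 - 36 * F + 15 * F ^ 2) + l ^ 3 * (12 - 13 * F) + 4 * l ^ 4 := by
  unfold bandDet
  ring

/-- The edge of the band next to the Dirac points. -/
theorem exists_dirac_edge {l : ℝ} (hl : 0 < l) (hl1 : l ≤ 1 / 1000000) :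
    ∃ F₀ : ℝ, l / 25 < F₀ ∧ F₀ < l / 16 ∧
      (∀ F, 0 ≤ F → F < F₀ → 0 < bandDet (F - 1) l (9 / 2) (27 / 8)) ∧
      ∀ F, F₀ ≤ F → F ≤ 1 → bandDet (F - 1) l (9 / 2) (27 / 8) ≤ 0 := by
  have hc : Continuous fun F : ℝ => bandDet (F - 1) l (9 / 2) (27 / 8) := by
    unfold bandDet
    fun_prop
  have hlo : 0 < bandDet (l / 25 - 1) l (9 / 2) (27 / 8) := by
    rw [bandDet_dirac]
    have e : l / 25 * (l / 25 - 4) ^ 3 + l * (4 - 33 * (l / 25) + 36 * (l / 25) ^ 2 -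
        7 * (l / 25) ^ 3) + l ^ 2 * (-15 - 36 * (l / 25) + 15 * (l / 25) ^ 2) +
        l ^ 3 * (12 - 13 * (l / 25)) + 4 * l ^ 4 =
        l * (36 / 25 + l * (-10152 / 625 + l * (165888 / 15625 + 1368576 / 390625 * l))) := by ring
    rw [e]
    apply mul_pos hl
    nlinarith [mul_pos hl hl, mul_pos (mul_pos hl hl) hl]
  -- At first order in `l` the terms `-64F` and `4l` cancel for `F = l/16`, so the sign, and hence
  -- the strict bound, comes from the negative `l²` term.
  have hhi : bandDet (l / 16 - 1) l (9 / 2) (27 / 8) < 0 := by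
    rw [bandDet_dirac]
    have hl2 : l ^ 2 ≤ 1 / 1000000 * l := by nlinarith
    have hl3 : l ^ 3 ≤ 1 / 1000000 * l ^ 2 := by nlinarith [sq_nonneg l]
    have hl4 : l ^ 4 ≤ 1 / 1000000 * l ^ 3 := by nlinarith [pow_pos hl 3]
    nlinarith [pow_pos hl 2, pow_pos hl 3, pow_pos hl 4]
  obtain ⟨F₀, ⟨h1, h2⟩, h0⟩ := intermediate_value_Icc' (by linarith : l / 25 ≤ l / 16)
    hc.continuousOn (⟨hhi.le, hlo.le⟩ : (0 : ℝ) ∈ Set.Icc _ _)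
  simp only at h0
  have h1' : l / 25 < F₀ := lt_of_le_of_ne h1 fun h => by rw [h, h0] at hlo; exact lt_irrefl _ hlo
  have h2' : F₀ < l / 16 := lt_of_le_of_ne h2 fun h => by rw [← h, h0] at hhi; exact lt_irrefl _ hhi
  have hF0 : 0 < F₀ := by linarith [div_pos hl (by norm_num : (0 : ℝ) < 25)]
  have hF1 : F₀ ≤ 1 / 1000000 := by linarith
  -- The quotient `R` is explicit; on `[0, 1]` its term `(F - 4)³ ≤ -27` outweighs all others, so
  -- `F₀` is the only sign change there.
  have hslope : ∀ F, 0 ≤ F → F ≤ 1 → ∃ R < 0,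
      bandDet (F - 1) l (9 / 2) (27 / 8) = (F - F₀) * R := fun F hF hF' => by
    refine ⟨(F - 4) ^ 3 + F₀ * ((F ^ 2 + F * F₀ + F₀ ^ 2) - 12 * (F + F₀) + 48) +
      l * (-33 + 36 * (F + F₀) - 7 * (F ^ 2 + F * F₀ + F₀ ^ 2)) +
      l ^ 2 * (-36 + 15 * (F + F₀)) - 13 * l ^ 3, ?_, ?_⟩
    · have e1 : (F - 4) ^ 3 ≤ -27 := by nlinarith [sq_nonneg (F - 4), sq_nonneg (F - 1)]
      have e2 : F₀ * ((F ^ 2 + F * F₀ + F₀ ^ 2) - 12 * (F + F₀) + 48) ≤ F₀ * 100 := by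
        gcongr
        nlinarith
      have e3 : l * (-33 + 36 * (F + F₀) - 7 * (F ^ 2 + F * F₀ + F₀ ^ 2)) ≤ l * 100 := by
        gcongr
        nlinarith [mul_nonneg hF hF0.le]
      have e4 : l ^ 2 * (-36 + 15 * (F + F₀)) ≤ l ^ 2 * 0 := by
        gcongr
        linarith
      have e5 : 0 < l ^ 3 := by positivity
      linarith
    · rw [← sub_zero (bandDet _ _ _ _), ← h0, bandDet_dirac, bandDet_dirac]
      ring
  refine ⟨F₀, h1', h2', fun F hF hF' => ?_, fun F hF hF' => ?_⟩
  · obtain ⟨R, hR, e⟩ := hslope F hF (by linarith)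
    rw [e]
    exact mul_pos_of_neg_of_neg (by linarith) hR
  · obtain ⟨R, hR, e⟩ := hslope F (by linarith) hF'
    rw [e]
    exact mul_nonpos_of_nonneg_of_nonpos (by linarith) hR.le

/-- The edges of the bands that come from the quasimomentum zero. -/
theorem exists_zero_edges {l : ℝ} (hl : 0 < l) (hl1 : l ≤ 1 / 1000000) :
    ∃ x₁ x₂ : ℝ, -(l / 8) < x₁ ∧ x₁ < -(l / 9) ∧ 8 < x₂ ∧ x₂ < 9 ∧
      ∀ x, bandDet x l 0 0 = (x - l) ^ 2 * ((x - x₁) * (x - x₂)) := by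
  have hc : Continuous fun x : ℝ => x ^ 2 - 8 * x - 5 * l * x - l + 4 * l ^ 2 := by fun_prop
  -- The small root is `-l/8` to first order; at `-l/8` the linear terms cancel and the positive
  -- `l²` terms decide the sign. The other root, `8 + 5l - x₁`, comes from the sum of the roots.
  obtain ⟨x₁, ⟨h1, h2⟩, h0⟩ := intermediate_value_Ioo' (by linarith : -(l / 8) ≤ -(l / 9))
    hc.continuousOn (⟨by nlinarith, by nlinarith⟩ : (0 : ℝ) ∈ Set.Ioo _ _)
  refine ⟨x₁, 8 + 5 * l - x₁, h1, h2, by linarith, by linarith, fun x => ?_⟩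
  unfold bandDet
  linear_combination (x - l) ^ 2 * h0

theorem bandDet_eq_bandDet_zero_add (x l m k : ℝ) :
    bandDet x l m k = bandDet x l 0 0 + 4 * m * (x + 2 * l) * (x - l) - 8 * k := by
  unfold bandDet
  ring

/-- The set of the squared energies of the spectrum. -/
theorem exists_bandDet_eq_zero_iff {l : ℝ} (hl : 0 < l) (hl1 : l ≤ 1 / 1000000) :
    ∃ F₀ F₁ F₂ : ℝ, l / 25 < F₀ ∧ F₀ < l / 16 ∧ 1 - l / 8 < F₁ ∧ F₁ < 1 - l / 9 ∧
      9 < F₂ ∧ ∀ F, 0 ≤ F →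
        ((∃ A B : ℝ, bandDet (F - 1) l (cosSum A B) (cosProd A B) = 0) ↔
          (F₀ ≤ F ∧ F ≤ F₁) ∨ (1 + l ≤ F ∧ F ≤ F₂)) := by
  obtain ⟨F₀, h1, h2, hdp, hdn⟩ := exists_dirac_edge hl hl1
  obtain ⟨x₁, x₂, h3, h4, h5, h6, hz⟩ := exists_zero_edges hl hl1
  refine ⟨F₀, 1 + x₁, 1 + x₂, h1, h2, by linarith, by linarith, by linarith, fun F hF => ?_⟩
  constructor
  · rintro ⟨A, B, h⟩
    have m0 := cosSum_nonneg A B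
    have m1 := cosSum_le A B
    have k0 := cosProd_nonneg A B
    have k1 := cosProd_le A B
    have k2 := three_mul_cosProd_le A B
    set m := cosSum A B
    set k := cosProd A B
    by_contra hcon
    rw [not_or, not_and_or, not_and_or, not_le, not_le, not_le, not_le] at hcon
    obtain ⟨hcon1, hcon2⟩ := hcon
    rcases hcon1 with hlt | hgt
    · have hd := hdp F hF hlt
      -- Below `F₀` the Dirac value is positive, and both corrections are nonnegative: the first by
      -- `cosProd_le`, the second by `m ≤ 9/2` and `hQ`.
      have e : bandDet (F - 1) l m k = bandDet (F - 1) l (9 / 2) (27 / 8) + (9 + 4 * m - 8 * k) +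
          4 * (9 / 2 - m) * (1 - (F - 1 + 2 * l) * (F - 1 - l)) := by
        unfold bandDet
        ring
      have hQ : (F - 1 + 2 * l) * (F - 1 - l) ≤ 1 := by nlinarith
      have : 0 ≤ 4 * (9 / 2 - m) * (1 - (F - 1 + 2 * l) * (F - 1 - l)) :=
        mul_nonneg (by linarith) (by linarith)
      linarith
    · rw [bandDet_eq_bandDet_zero_add, hz] at h
      rcases hcon2 with hlt | hgt2
      -- Inside the gap `x₁ < x < l`, the value at quasimomentum zero is negative, and both `4m(x +
      -- 2l)(x - l)` and `-8k` are nonpositive.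
      · have e1 : (F - 1 - l) ^ 2 * ((F - 1 - x₁) * (F - 1 - x₂)) < 0 :=
          mul_neg_of_pos_of_neg (by nlinarith)
            (mul_neg_of_pos_of_neg (by linarith) (by linarith))
        have e2 : 4 * m * (F - 1 + 2 * l) * (F - 1 - l) ≤ 0 :=
          mul_nonpos_of_nonneg_of_nonpos (mul_nonneg (by linarith) (by linarith)) (by linarith)
        linarith
      -- Above the top edge, the term in `m` is at least `32m`, which absorbs `8k` because `3k ≤
      -- 4m`.
      · have e1 : 0 < (F - 1 - l) ^ 2 * ((F - 1 - x₁) * (F - 1 - x₂)) :=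
          mul_pos (by nlinarith) (mul_pos (by linarith) (by linarith))
        have e2 : 4 * m * 8 * 1 ≤ 4 * m * (F - 1 + 2 * l) * (F - 1 - l) :=
          mul_le_mul (mul_le_mul_of_nonneg_left (by linarith) (by linarith)) (by linarith)
            zero_le_one (mul_nonneg (by linarith) (by linarith))
        linarith
  · rintro (⟨hlo, hhi⟩ | ⟨hlo, hhi⟩)
    · refine exists_bandDet_eq_zero (A := 2 * Real.pi / 3) (B := -(2 * Real.pi / 3))
        (A' := 0) (B' := 0) ?_ ?_
      · rw [cosSum_cosProd_dirac.1, cosSum_cosProd_dirac.2]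
        exact hdn F hlo (by linarith)
      · rw [cosSum_cosProd_zero.1, cosSum_cosProd_zero.2, hz]
        exact mul_nonneg (sq_nonneg _) (mul_nonneg_of_nonpos_of_nonpos (by linarith) (by linarith))
    · have h00 : bandDet (F - 1) l (cosSum 0 0) (cosProd 0 0) ≤ 0 := by
        rw [cosSum_cosProd_zero.1, cosSum_cosProd_zero.2, hz]
        exact mul_nonpos_of_nonneg_of_nonpos (sq_nonneg _)
          (mul_nonpos_of_nonneg_of_nonpos (by linarith) (by linarith))
      -- At `λ = 0` the value at `(0, π)` is `x²(x - 4)²`, which degenerates at `F = 5`, and the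
      -- Dirac value is `F(F - 4)³`, positive only beyond `F = 4`. The split at `21/5`, between `4`
      -- and `5`, keeps each one usable under the perturbation.
      rcases le_total F (21 / 5) with hF2 | hF2
      · refine exists_bandDet_eq_zero (A' := 0) (B' := Real.pi) h00 ?_
        rw [cosSum_cosProd_pi.1, cosSum_cosProd_pi.2]
        obtain ⟨x, rfl⟩ : ∃ x, F = x + 1 := ⟨F - 1, by ring⟩
        have hx0 : 0 < x := by linarith
        have e : bandDet (x + 1 - 1) l 4 0 = (x - l) * (x * (x - 4) ^ 2 +
            l * (32 + 7 * x - 6 * x ^ 2 + l * (9 * x + 1 - 4 * l))) := by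
          unfold bandDet
          ring
        rw [e]
        refine mul_nonneg (by linarith) ?_
        have e1 : x * (16 / 25) ≤ x * (x - 4) ^ 2 := by
          gcongr
          nlinarith
        have e2 : l * (-6 * x * 4) ≤
            l * (32 + 7 * x - 6 * x ^ 2 + l * (9 * x + 1 - 4 * l)) := by
          gcongr
          have : 0 ≤ l * (9 * x + 1 - 4 * l) := mul_nonneg hl.le (by linarith)
          nlinarith
        nlinarith
      · refine exists_bandDet_eq_zero (A' := 2 * Real.pi / 3) (B' := -(2 * Real.pi / 3)) h00 ?_
        rw [cosSum_cosProd_dirac.1, cosSum_cosProd_dirac.2, bandDet_dirac]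
        have hF10 : F ≤ 10 := by linarith
        have e1 : 21 / 5 * (1 / 5) ^ 3 ≤ F * (F - 4) ^ 3 := by
          gcongr
          linarith
        have e2 : l * (-8000) ≤ l * (4 - 33 * F + 36 * F ^ 2 - 7 * F ^ 3) := by
          gcongr
          have : F ^ 3 ≤ 10 ^ 3 := by gcongr
          nlinarith
        have e3 : l ^ 2 * (-400) ≤ l ^ 2 * (-15 - 36 * F + 15 * F ^ 2) := by
          gcongr
          nlinarith
        have e4 : l ^ 3 * (-200) ≤ l ^ 3 * (12 - 13 * F) := by
          gcongr
          linarith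
        have e5 : l ^ 2 ≤ l * 1 := by nlinarith
        have e6 : l ^ 3 ≤ l * 1 := by nlinarith [sq_nonneg l]
        have e7 : 0 < l ^ 4 := by positivity
        linarith

/-! ### Counting components -/

/-- A continuous map to a discrete space is constant on components, and preconnected fibres make the
induced map on components injective. -/
theorem card_connectedComponents_of_fibers {X : Type*} [TopologicalSpace X] {n : ℕ}
    {f : X → Fin n} (hf : Continuous f) (hs : Function.Surjective f)
    (hp : ∀ i, IsPreconnected (f ⁻¹' {i})) : Nat.card (ConnectedComponents X) = n := by
  have hb : Function.Bijective hf.connectedComponentsLift := by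
    constructor
    · intro p q h
      obtain ⟨x, rfl⟩ := ConnectedComponents.surjective_coe p
      obtain ⟨y, rfl⟩ := ConnectedComponents.surjective_coe q
      rw [hf.connectedComponentsLift_apply_coe, hf.connectedComponentsLift_apply_coe] at h
      rw [ConnectedComponents.coe_eq_coe']
      exact (hp (f y)).subset_connectedComponent (Set.mem_singleton _) h
    · intro i
      obtain ⟨x, rfl⟩ := hs i
      exact ⟨x, hf.connectedComponentsLift_apply_coe x⟩
  rw [Nat.card_eq_of_bijective _ hb, Nat.card_fin]

/-- A set that consists of two symmetric pairs of intervals has four components. -/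
theorem card_connectedComponents_of_abs {S : Set ℝ} {a b c d : ℝ} (ha : 0 < a) (hab : a ≤ b)
    (hbc : b < c) (hcd : c ≤ d)
    (hS : ∀ E, E ∈ S ↔ (a ≤ |E| ∧ |E| ≤ b) ∨ (c ≤ |E| ∧ |E| ≤ d)) :
    Nat.card (ConnectedComponents S) = 4 := by
  set e := (b + c) / 2 with he
  have hbe : b < e := by rw [he]; linarith
  have hec : e < c := by rw [he]; linarith
  clear_value e
  -- The fibres of the labelling `g` on `S` are both the closed intervals `I`, which gives
  -- connectedness, and the traces of the open sets `J`, which gives continuity. The values of `g`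
  -- at `0` and `±e` are immaterial, as these points are not in `S`.
  let I : Fin 4 → Set ℝ := ![Set.Icc (-d) (-c), Set.Icc (-b) (-a), Set.Icc a b, Set.Icc c d]
  let J : Fin 4 → Set ℝ := ![Set.Iio (-e), Set.Ioo (-e) 0, Set.Ioo 0 e, Set.Ioi e]
  let g : ℝ → Fin 4 := fun E =>
    if E < 0 then (if E < -e then 0 else 1) else (if E < e then 2 else 3)
  have hJg : ∀ i, ∀ E ∈ J i, g E = i := by
    rw [Fin.forall_fin_succ, Fin.forall_fin_succ, Fin.forall_fin_succ, Fin.forall_fin_one]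
    refine ⟨fun E hE => ?_, fun E hE => ?_, fun E hE => ?_, fun E hE => ?_⟩
    · change E < -e at hE
      exact (if_pos (by linarith)).trans (if_pos hE)
    · change -e < E ∧ E < 0 at hE
      exact (if_pos hE.2).trans (if_neg (by linarith))
    · change 0 < E ∧ E < e at hE
      exact (if_neg (by linarith)).trans (if_pos hE.2)
    · change e < E at hE
      exact (if_neg (by linarith)).trans (if_neg (by linarith))
  have hIJ : ∀ i, I i ⊆ J i := by
    rw [Fin.forall_fin_succ, Fin.forall_fin_succ, Fin.forall_fin_succ, Fin.forall_fin_one]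
    refine ⟨fun E hE => ?_, fun E hE => ?_, fun E hE => ?_, fun E hE => ?_⟩
    · change -d ≤ E ∧ E ≤ -c at hE
      change E < -e
      linarith
    · change -b ≤ E ∧ E ≤ -a at hE
      exact ⟨by linarith, by linarith⟩
    · change a ≤ E ∧ E ≤ b at hE
      exact ⟨by linarith, by linarith⟩
    · change c ≤ E ∧ E ≤ d at hE
      change e < E
      linarith
  have hSI : ∀ E, E ∈ S ↔ ∃ i, E ∈ I i := fun E => by
    rw [hS, Fin.exists_fin_succ, Fin.exists_fin_succ, Fin.exists_fin_succ, Fin.exists_fin_one]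
    change _ ↔ (-d ≤ E ∧ E ≤ -c) ∨ (-b ≤ E ∧ E ≤ -a) ∨ (a ≤ E ∧ E ≤ b) ∨ (c ≤ E ∧ E ≤ d)
    rcases abs_cases E with ⟨h, _⟩ | ⟨h, _⟩ <;> rw [h] <;> constructor
    · rintro (h | h)
      · exact Or.inr (Or.inr (Or.inl h))
      · exact Or.inr (Or.inr (Or.inr h))
    · rintro (h | h | h | h)
      · linarith
      · linarith
      · exact Or.inl h
      · exact Or.inr h
    · rintro (h | h)
      · exact Or.inr (Or.inl ⟨by linarith, by linarith⟩)
      · exact Or.inl ⟨by linarith, by linarith⟩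
    · rintro (h | h | h | h)
      · exact Or.inr ⟨by linarith, by linarith⟩
      · exact Or.inl ⟨by linarith, by linarith⟩
      · linarith
      · linarith
  have hgI : ∀ E ∈ S, E ∈ I (g E) := fun E hE => by
    obtain ⟨i, hi⟩ := (hSI E).mp hE
    rwa [hJg i E (hIJ i hi)]
  have hIS : ∀ i, I i ⊆ S := fun i E hE => (hSI E).mpr ⟨i, hE⟩
  let f : S → Fin 4 := fun E => g E
  have hfI : ∀ i, f ⁻¹' {i} = Subtype.val ⁻¹' I i := fun i => by
    ext ⟨E, hE⟩
    exact ⟨fun h => (show g E = i from h) ▸ hgI E hE, fun h => hJg i E (hIJ i h)⟩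
  have hfJ : ∀ i, f ⁻¹' {i} = Subtype.val ⁻¹' J i := fun i => by
    ext ⟨E, hE⟩
    exact ⟨fun h => hIJ i ((show g E = i from h) ▸ hgI E hE), fun h => hJg i E h⟩
  have hne : ∀ i, (I i).Nonempty := by
    rw [Fin.forall_fin_succ, Fin.forall_fin_succ, Fin.forall_fin_succ, Fin.forall_fin_one]
    exact ⟨Set.nonempty_Icc.mpr (by linarith), Set.nonempty_Icc.mpr (by linarith),
      Set.nonempty_Icc.mpr hab, Set.nonempty_Icc.mpr hcd⟩
  have hIc : ∀ i, IsPreconnected (I i) := by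
    rw [Fin.forall_fin_succ, Fin.forall_fin_succ, Fin.forall_fin_succ, Fin.forall_fin_one]
    exact ⟨isPreconnected_Icc, isPreconnected_Icc, isPreconnected_Icc, isPreconnected_Icc⟩
  have hJo : ∀ i, IsOpen (J i) := by
    rw [Fin.forall_fin_succ, Fin.forall_fin_succ, Fin.forall_fin_succ, Fin.forall_fin_one]
    exact ⟨isOpen_Iio, isOpen_Ioo, isOpen_Ioo, isOpen_Ioi⟩
  refine card_connectedComponents_of_fibers (f := f) ?_ (fun i => ?_) fun i => ?_
  · refine continuous_discrete_rng.mpr fun i => ?_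
    rw [hfJ]
    exact (hJo i).preimage continuous_subtype_val
  · obtain ⟨E, hE⟩ := hne i
    exact ⟨⟨E, hIS i hE⟩, hJg i E (hIJ i hE)⟩
  · rw [hfI, ← Topology.IsInducing.subtypeVal.isPreconnected_image, Subtype.image_preimage_coe,
      Set.inter_eq_self_of_subset_right (hIS i)]
    exact hIc i

/-! ### The gaps and their sizes -/

theorem theorem4p2 :
    ∃ lam₀ : ℝ, 0 < lam₀ ∧ ∀ lam : ℝ, 0 < |lam| → |lam| < lam₀ →
      Nat.card (ConnectedComponents (hexSpectrum lam)) = 4 ∧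
      (∀ E : ℝ, E = 1 ∨ E = -1 →
        ∃ a b : ℝ, IsGap (hexSpectrum lam) a b ∧
          Set.Ioo (E - lam ^ 2 / 20) (E + lam ^ 2 / 20) ⊂ Set.Ioo a b ∧
          Set.Ioo a b ⊆ Set.Ioo (E - lam ^ 2 / 2) (E + lam ^ 2 / 2)) ∧
      (∃ a b : ℝ, IsGap (hexSpectrum lam) a b ∧
        Set.Ioo (-(|lam| / 5)) (|lam| / 5) ⊂ Set.Ioo a b ∧
        Set.Ioo a b ⊂ Set.Ioo (-(|lam| / 4)) (|lam| / 4)) := by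
  refine ⟨1 / 1000, by norm_num, fun lam h0 h1 => ?_⟩
  have hl : 0 < lam ^ 2 := by rw [← sq_abs]; positivity
  have hl1 : lam ^ 2 ≤ 1 / 1000000 := by rw [← sq_abs]; nlinarith
  obtain ⟨F₀, F₁, F₂, b1, b2, b3, b4, b5, hF⟩ := exists_bandDet_eq_zero_iff hl hl1
  rw [← sq_abs lam] at b1 b2
  have hFpos : 0 < F₀ := lt_trans (by positivity) b1
  have hF0 : 0 < √F₀ := Real.sqrt_pos.mpr hFpos
  have hF01 : √F₀ < √F₁ := Real.sqrt_lt_sqrt hFpos.le (by rw [sq_abs] at b2; linarith)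
  have hF12 : √F₁ < √(1 + lam ^ 2) := Real.sqrt_lt_sqrt (by linarith) (by linarith)
  have hF23 : √(1 + lam ^ 2) < √F₂ := Real.sqrt_lt_sqrt (by linarith) (by linarith)
  have hS : ∀ E, E ∈ hexSpectrum lam ↔
      (√F₀ ≤ |E| ∧ |E| ≤ √F₁) ∨ (√(1 + lam ^ 2) ≤ |E| ∧ |E| ≤ √F₂) := fun E => by
    rw [mem_hexSpectrum_iff, hF _ (sq_nonneg E), ← sq_abs E, Real.sqrt_le_left (abs_nonneg E),
      Real.sqrt_le_left (abs_nonneg E), Real.le_sqrt (abs_nonneg E), Real.le_sqrt (abs_nonneg E)] <;>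
      linarith
  -- After squaring, `(1 - l/20)² ≥ 1 - l/10 > 1 - l/9 > F₁` with `l = λ²`.
  have hu1 : √F₁ < 1 - lam ^ 2 / 20 := by
    rw [Real.sqrt_lt' (by linarith)]
    nlinarith
  have hu2 : 1 - lam ^ 2 / 2 < √F₁ := by
    rw [Real.lt_sqrt (by linarith)]
    nlinarith
  have hu3 : 1 + lam ^ 2 / 20 < √(1 + lam ^ 2) := by
    rw [Real.lt_sqrt (by linarith)]
    nlinarith
  -- The outer constant `1/2` is the first-order coefficient of this exact gap edge; strictness
  -- comes from the square of `λ²/2`.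
  have hu4 : √(1 + lam ^ 2) < 1 + lam ^ 2 / 2 := by
    rw [Real.sqrt_lt' (by linarith)]
    nlinarith
  -- Squaring turns the constants `1/5` and `1/4` into the bounds `l/25` and `l/16` on `F₀`.
  have hu5 : |lam| / 5 < √F₀ := by
    rw [Real.lt_sqrt (by positivity)]
    linarith
  have hu6 : √F₀ < |lam| / 4 := by
    rw [Real.sqrt_lt' (by positivity)]
    linarith
  have hss : ∀ a b c d : ℝ, c < a → a < b → b < d → Set.Ioo a b ⊂ Set.Ioo c d :=
    fun a b c d hca hab hbd => by
      rw [Set.ssubset_iff_of_subset (Set.Ioo_subset_Ioo hca.le hbd.le)]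
      exact ⟨a, ⟨hca, by linarith⟩, fun h => lt_irrefl _ h.1⟩
  refine ⟨card_connectedComponents_of_abs hF0 hF01.le hF12 hF23.le hS, ?_, ?_⟩
  · rintro E (rfl | rfl)
    · refine ⟨√F₁, √(1 + lam ^ 2), ⟨hF12, ?_, ?_, ?_⟩, hss _ _ _ _ hu1 (by linarith) hu3,
        Set.Ioo_subset_Ioo hu2.le hu4.le⟩
      · rw [hS, abs_of_nonneg (Real.sqrt_nonneg _)]
        exact Or.inl ⟨hF01.le, le_rfl⟩
      · rw [hS, abs_of_nonneg (Real.sqrt_nonneg _)]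
        exact Or.inr ⟨le_rfl, hF23.le⟩
      · rw [Set.disjoint_left]
        rintro E ⟨h2, h3⟩ hE
        rw [hS, abs_of_pos (by linarith)] at hE
        rcases hE with hE | hE <;> linarith [hE.1, hE.2]
    · refine ⟨-√(1 + lam ^ 2), -√F₁, ⟨by linarith, ?_, ?_, ?_⟩,
        hss _ _ _ _ (by linarith) (by linarith) (by linarith),
        Set.Ioo_subset_Ioo (by linarith) (by linarith)⟩
      · rw [hS, abs_neg, abs_of_nonneg (Real.sqrt_nonneg _)]
        exact Or.inr ⟨le_rfl, hF23.le⟩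
      · rw [hS, abs_neg, abs_of_nonneg (Real.sqrt_nonneg _)]
        exact Or.inl ⟨hF01.le, le_rfl⟩
      · rw [Set.disjoint_left]
        rintro E ⟨h2, h3⟩ hE
        rw [hS, abs_of_neg (by linarith)] at hE
        rcases hE with hE | hE <;> linarith [hE.1, hE.2]
  · refine ⟨-√F₀, √F₀, ⟨by linarith, ?_, ?_, ?_⟩,
      hss _ _ _ _ (by linarith) (by linarith) hu5, hss _ _ _ _ (by linarith) (by linarith) hu6⟩
    · rw [hS, abs_neg, abs_of_nonneg (Real.sqrt_nonneg _)]
      exact Or.inl ⟨le_rfl, hF01.le⟩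
    · rw [hS, abs_of_nonneg (Real.sqrt_nonneg _)]
      exact Or.inl ⟨le_rfl, hF01.le⟩
    · rw [Set.disjoint_left]
      rintro E hE' hE
      have h2 := abs_lt.mpr hE'
      rw [hS] at hE
      rcases hE with hE | hE <;> linarith [hE.1]
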